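/- Let $P$ be a connected directed planar (multi)graph, embedded in the sphere, in which every arc $uv$ has an antiparallel arc $vu$ embedded on the same curve. The arcs have lengths in $\mathbb R\cup\{+\infty\}$ (the lengths of an arc and its reverse may differ), and there is no directed cycle of negative length; $d(u,v)$ denotes shortest-path distance. Let $r,g,b$ be three distinct vertices (sites) from each of which every vertex is at finite distance, and let $\omega(g),\omega(b)$ be real weights such that $\omega(g)+d(g,v)\neq\omega(b)+d(b,v)$ for every vertex $v$. The dual $e^*$ of an arc $e$ goes from the face to the left of $e$ to the face to the right of $e$. The bisector $\beta^*(g,b)$ is the set of duals of those arcs $uv$ with $\omega(g)+d(g,u)<\omega(b)+d(b,u)$ and $\omega(b)+d(b,v)<\omega(g)+d(g,v)$; if it is non-empty, it is a simple directed cycle in the dual graph (and this is part of the claim). For a vertex $v$ put $\Delta^r(v)=\min\{\omega(g)+d(g,v),\,\omega(b)+d(b,v)\}-d(r,v)$, and for an edge $uv$ and its dual put $\Delta^r((uv)^*)=\Delta^r(uv)=\max\{\Delta^r(u),\Delta^r(v)\}$. For real $x$ let $\mathrm{VD}_x$ be the additively weighted Voronoi diagram of $r,g,b$ with weights $x,\omega(g),\omega(b)$: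 each vertex belongs to the cell of the site that minimizes weight plus distance, and ties with $r$ are resolved in favour of $r$ (so $v$ is in the cell of $r$ exactly when $x\le\Delta^r(v)$). A face is trichromatic in $\mathrm{VD}_x$ if it has an incident vertex in each of the three cells. Let $Q^*_{\ge x}=\{e^*\in\beta^*(g,b):\Delta^r(e^*)\ge x\}$. Suppose that $\beta^*(g,b)\neq\emptyset$. Then: 1. For every $x\in\mathbb R$, the edges of $Q^*_{\ge x}$ form a contiguous (possibly empty, possibly full) subpath of the cycle $\beta^*(g,b)$. If $Q^*_{\ge x}$ is non-empty and does not contain all edges of $\beta^*(g,b)$, then the trichromatic faces of $\mathrm{VD}_x$ are exactly the faces dual to the two endpoints of this subpath, that is, exactly the faces whose duals have exactly one incident edge in $Q^*_{\ge x}$. 2. The cyclic sequence $(\Delta^r(e^*))_{e^*\in\beta^*(g,b)}$, in the order along the cycle, is weakly bitonic: it can be cut at some element so that the sequence read once around the cycle, from that element back to itself, is first weakly decreasing and then weakly increasing. 3. If $r$, $g$ and $b$ are all incident to one face $h$, then $\beta^*(g,b)$ passes through the dual vertex $h^*$, and the sequence of the values $\Delta^r(e^*)$, read along $\beta^*(g,b)$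 as a path that starts and ends at $h^*$, is weakly monotone (weakly increasing or weakly decreasing). -/

import Mathlib

/-- A connected plane (multi)graph, given by its combinatorial embedding. `D` is the set of arcs
(darts); every arc `d` has an antiparallel arc `rev d` embedded on the same curve; `rot d` is the
next arc, in clockwise order, among the arcs with the same tail as `d`. The faces are the orbits of
`rot * rev`, and Euler's formula `|V| - |D| / 2 + |F| = 2` says that the embedding is in the
sphere. -/
structure PlaneGraph (V D : Type*) [Fintype V] [Fintype D] where
  tail : D → V
  rev : Equiv.Perm D
  rot : Equiv.Perm D
  rev_rev : ∀ d, rev (rev d) = d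
  rev_ne : ∀ d, rev d ≠ d
  rot_sameCycle : ∀ d d', rot.SameCycle d d' ↔ tail d = tail d'
  connected : ∀ u v, Relation.ReflTransGen (fun a b => ∃ d, tail d = a ∧ tail (rev d) = b) u v
  euler : 2 * (Fintype.card V + Nat.card (Quotient (Equiv.Perm.SameCycle.setoid (rot * rev))))
    = Fintype.card D + 4

namespace PlaneGraph

variable {V D : Type*} [Fintype V] [Fintype D] (P : PlaneGraph V D)

/-- The head of an arc. -/
def head (d : D) : V := P.tail (P.rev d)

/-- The faces of the embedding, that is, the vertices of the dual graph. -/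
def Face : Type _ := Quotient (Equiv.Perm.SameCycle.setoid (P.rot * P.rev))

/-- The face to the left of an arc: the tail of the dual arc. -/
def leftFace (d : D) : P.Face := Quotient.mk (Equiv.Perm.SameCycle.setoid (P.rot * P.rev)) d

/-- The face to the right of an arc: the head of the dual arc. -/
def rightFace (d : D) : P.Face := P.leftFace (P.rev d)

/-- The vertex `v` lies on the boundary of the face `f`. -/
def Incident (f : P.Face) (v : V) : Prop := ∃ d, P.leftFace d = f ∧ P.tail d = v

/-- `p` is the list of arcs of a directed walk from `u` to `v`. -/
def IsWalk : V → List D → V → Prop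
  | u, [], v => u = v
  | u, d :: p, v => P.tail d = u ∧ IsWalk (P.head d) p v

/-- The length of a walk; single arcs may have length `+∞`. -/
def walkLength (ℓ : D → WithTop ℝ) (p : List D) : WithTop ℝ := (p.map ℓ).sum

/-- There is no directed cycle of negative length. -/
def NoNegativeCycle (ℓ : D → WithTop ℝ) : Prop :=
  ∀ v p, P.IsWalk v p v → 0 ≤ walkLength ℓ p

/-- There is a walk of finite length from `u` to `v`. -/
def FinitelyReachable (ℓ : D → WithTop ℝ) (u v : V) : Prop :=
  ∃ p, P.IsWalk u p v ∧ walkLength ℓ p ≠ ⊤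

/-- The shortest-path distance `d(u, v)`. It is used only where there is no negative cycle and `v`
is reachable from `u` by a walk of finite length; the infimum is then over a non-empty set of reals
that is bounded below. -/
noncomputable def dist (ℓ : D → WithTop ℝ) (u v : V) : ℝ :=
  sInf {a : ℝ | ∃ p, P.IsWalk u p v ∧ walkLength ℓ p = (a : WithTop ℝ)}

/-- The Voronoi cell of the site `u` in the additively weighted Voronoi diagram of `S`, `ω`:
the vertices closer to `u` than to every other site. -/
def vor (ℓ : D → WithTop ℝ) (S : Set V) (ω : V → ℝ) (u : V) : Set V :=
  {v | ∀ u' ∈ S, u' ≠ u → ω u + P.dist ℓ u v < ω u' + P.dist ℓ u' v}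

/-- The Voronoi cell of the site `u`, where vertices at which the site `r` ties with the other
nearest sites are given to `r`. -/
def vorTie (ℓ : D → WithTop ℝ) (S : Set V) (ω : V → ℝ) (r u : V) : Set V :=
  {v | ∀ u' ∈ S, u' ≠ u → ω u + P.dist ℓ u v < ω u' + P.dist ℓ u' v ∨
    (u = r ∧ ω u + P.dist ℓ u v = ω u' + P.dist ℓ u' v)}

/-- The tie-breaking rule matters only if `r` is tied with another site. -/
theorem vorTie_eq_vor (ℓ : D → WithTop ℝ) (S : Set V) (ω : V → ℝ) (r u : V)
    (h : ∀ u' ∈ S, u' ≠ r → ∀ v, ω r + P.dist ℓ r v ≠ ω u' + P.dist ℓ u' v) :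
    P.vorTie ℓ S ω r u = P.vor ℓ S ω u := by
  ext v
  constructor
  · intro hv u' hu' hne
    rcases hv u' hu' hne with h1 | ⟨rfl, h2⟩
    · exact h1
    · exact absurd h2 (h u' hu' hne v)
  · intro hv u' hu' hne
    exact Or.inl (hv u' hu' hne)

/-- The bisector `β*(g, b)`: (the duals of) the arcs whose tail is closer to `g` than to `b` and
whose head is closer to `b` than to `g`. A dual arc is represented by its primal arc. -/
def bisector (ℓ : D → WithTop ℝ) (ω : V → ℝ) (g b : V) : Set D :=
  {d | P.tail d ∈ P.vor ℓ {g, b} ω g ∧ P.head d ∈ P.vor ℓ {g, b} ω b}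

/-- The number `δ̃^{rc}(v) = ω(c) + d(c, v) - d(r, v)`. -/
noncomputable def deltaTilde (ℓ : D → WithTop ℝ) (ω : V → ℝ) (r c v : V) : ℝ :=
  ω c + P.dist ℓ c v - P.dist ℓ r v

/-- `Δ^r(v)`, with respect to the sites `g`, `b`. -/
noncomputable def vertexDelta (ℓ : D → WithTop ℝ) (ω : V → ℝ) (r g b v : V) : ℝ :=
  min (P.deltaTilde ℓ ω r g v) (P.deltaTilde ℓ ω r b v)

/-- `Δ^r(uv) = max (Δ^r(u), Δ^r(v))` for an edge `uv`; also `Δ^r` of the dual edge. -/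
noncomputable def edgeDelta (ℓ : D → WithTop ℝ) (ω : V → ℝ) (r g b : V) (d : D) : ℝ :=
  max (P.vertexDelta ℓ ω r g b (P.tail d)) (P.vertexDelta ℓ ω r g b (P.head d))

/-- `Q*_{≥ x}`: the edges of `β*(g, b)` with `Δ^r ≥ x`. -/
def Qge (ℓ : D → WithTop ℝ) (ω : V → ℝ) (r g b : V) (x : ℝ) : Set D :=
  {d | d ∈ P.bisector ℓ ω g b ∧ x ≤ P.edgeDelta ℓ ω r g b d}

/-- The cell of the site `u` in `VD_x`, the Voronoi diagram of `r`, `g`, `b` in which `r` has weight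
`x`. Since `Δ^r(v)` is to be the maximum weight of `r` for which `v` is red, ties go to `r`. -/
def cellAt [DecidableEq V] (ℓ : D → WithTop ℝ) (ω : V → ℝ) (r g b : V) (x : ℝ) (u : V) : Set V :=
  P.vorTie ℓ {r, g, b} (Function.update ω r x) r u

/-- The face `f` is trichromatic in `VD_x`: it has an incident vertex in each of the three cells. -/
def Trichromatic [DecidableEq V] (ℓ : D → WithTop ℝ) (ω : V → ℝ) (r g b : V) (x : ℝ)
    (f : P.Face) : Prop :=
  ∀ u ∈ ({r, g, b} : Set V), ∃ v ∈ P.cellAt ℓ ω r g b x u, P.Incident f v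

/-- `c` enumerates the arcs of `B` in the (cyclic) order of a simple directed cycle of the dual
graph: each dual arc ends where the next one starts, and no dual vertex is repeated. -/
def IsSimpleDualCycle {n : ℕ} (c : ZMod n → D) (B : Set D) : Prop :=
  Set.range c = B ∧ (∀ i, P.rightFace (c i) = P.leftFace (c (i + 1))) ∧
    Function.Injective (fun i => P.leftFace (c i))

end PlaneGraph

/-- The linear sequence `a 0, …, a n` is weakly bitonic: it is weakly decreasing, then weakly
increasing. -/
def IsWeaklyBitonic (n : ℕ) (a : ℕ → ℝ) : Prop :=
  ∃ k ≤ n, AntitoneOn a (Set.Icc 0 k) ∧ MonotoneOn a (Set.Icc k n)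

/-- The cyclic sequence `a` is weakly bitonic: some cyclic shift of it, which starts and ends at
the same (then necessarily maximum) element, is weakly bitonic. -/
def IsCyclicallyWeaklyBitonic {n : ℕ} (a : ZMod n → ℝ) : Prop :=
  ∃ s : ZMod n, IsWeaklyBitonic n (fun t => a (s + (t : ZMod n)))

/-! The topology enters as homology over `ℚ`. Vertex coboundaries and face coboundaries are
orthogonal, and by Euler's formula they together span all antisymmetric functions on the arcs
(`exists_coboundary_add_coface`). Hence a closed dual chain is the coboundary of a vertex potential
(`IsDualChain.exists_potential`), a substitute for the Jordan curve theorem. If such a chain crosses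
no edge inside either of two connected sets, the potential is constant on both, so the chain crosses
all arcs from one to the other equally often (`IsDualChain.eq_of_connSet`). `ConnSet` is phrased
through potentials for this reason. One consequence is that a bond is a simple dual cycle
(`exists_isSimpleDualCycle_cut`).

The metric enters only through connectedness of cells. All vertices on a nearly shortest walk from a
site to a vertex of its cell lie in that cell (`connSet_cell`). This applies to the cells of `g` and
`b` alone, so the bisector is a bond, and to the three cells of `VD_x` (`connSet_cells`).

An edge of the bisector has `Δ^r ≥ x` exactly when it has an endpoint in the red cell `R`. Suppose
some bisector edges do and some do not. Take a maximal run of edges avoiding `R`. Its two end faces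
meet `R`, so it can be closed up along the boundary of `R` without crossing any edge that avoids
`R`. The closed chain crosses all bisector arcs avoiding `R` equally often, so they all lie in this
one run (`mem_segment_of_mem_segment`). The same argument, with a run cut short, identifies the
trichromatic faces with the ends of the run (`exists_interval_of_cells`).

Bitonicity only uses that all superlevel sets are cyclic intervals. If the sites lie on a common
face, that face is trichromatic for every level whose superlevel set is proper and non-empty. It is
then an end of every such interval, which forces monotonicity. -/

namespace PlaneGraph

variable {V D : Type*} [Fintype V] [Fintype D] (P : PlaneGraph V D)

/-! ### Faces and the dual graph -/

/-- The next arc on the boundary of the face to the left of an arc. -/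
def faceNext : Equiv.Perm D := P.rot * P.rev

theorem tail_rot (d : D) : P.tail (P.rot d) = P.tail d :=
  ((P.rot_sameCycle d (P.rot d)).1 ⟨1, by simp⟩).symm

theorem tail_faceNext (d : D) : P.tail (P.faceNext d) = P.head d := P.tail_rot (P.rev d)

theorem head_rev (d : D) : P.head (P.rev d) = P.tail d := by rw [head, P.rev_rev]

theorem tail_rev (d : D) : P.tail (P.rev d) = P.head d := rfl

theorem rightFace_rev (d : D) : P.rightFace (P.rev d) = P.leftFace d := by
  rw [rightFace, P.rev_rev]

theorem leftFace_rev (d : D) : P.leftFace (P.rev d) = P.rightFace d := rfl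

theorem leftFace_eq_iff (d e : D) :
    P.leftFace d = P.leftFace e ↔ P.faceNext.SameCycle d e :=
  Quotient.eq (r := Equiv.Perm.SameCycle.setoid (P.rot * P.rev))

theorem leftFace_faceNext (d : D) : P.leftFace (P.faceNext d) = P.leftFace d :=
  (P.leftFace_eq_iff _ _).2 ⟨-1, by simp⟩

theorem exists_leftFace_eq (f : P.Face) : ∃ d, P.leftFace d = f := Quotient.exists_rep f

instance : Finite P.Face :=
  inferInstanceAs (Finite (Quotient (Equiv.Perm.SameCycle.setoid (P.rot * P.rev))))

theorem incident_tail (d : D) : P.Incident (P.leftFace d) (P.tail d) := ⟨d, rfl, rfl⟩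

theorem incident_head (d : D) : P.Incident (P.leftFace d) (P.head d) :=
  ⟨P.faceNext d, P.leftFace_faceNext d, P.tail_faceNext d⟩

theorem incident_right_tail (d : D) : P.Incident (P.rightFace d) (P.tail d) := by
  simpa [leftFace_rev, head_rev] using P.incident_head (P.rev d)

theorem incident_right_head (d : D) : P.Incident (P.rightFace d) (P.head d) :=
  P.incident_tail (P.rev d)

/-- A function on the faces that does not change across any edge is constant. -/
theorem face_function_const {α : Type*} (q : P.Face → α)
    (hq : ∀ d, q (P.leftFace d) = q (P.rightFace d)) (f f' : P.Face) : q f = q f' := by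
  -- Turning by one arc around a vertex crosses a single edge, since `rot d = faceNext (rev d)`.
  have hrot : ∀ d, q (P.leftFace (P.rot d)) = q (P.leftFace d) := fun d => by
    have h := P.leftFace_faceNext (P.rev d)
    simp only [faceNext, Equiv.Perm.mul_apply, P.rev_rev] at h
    rw [h, hq d, leftFace_rev]
  have hcyc : ∀ d e, P.tail d = P.tail e → q (P.leftFace d) = q (P.leftFace e) := fun d e h => by
    classical
    obtain ⟨k, -, -, hk⟩ := ((P.rot_sameCycle d e).2 h).exists_pow_eq
    rw [← hk]
    clear hk
    induction k with
    | zero => rfl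
    | succ k ih => rw [pow_succ', Equiv.Perm.mul_apply, hrot, ih]
  obtain ⟨d, rfl⟩ := P.exists_leftFace_eq f
  obtain ⟨d', rfl⟩ := P.exists_leftFace_eq f'
  have key : ∀ v, Relation.ReflTransGen (fun a b => ∃ d, P.tail d = a ∧ P.tail (P.rev d) = b)
      (P.tail d) v → ∀ e, P.tail e = v → q (P.leftFace d) = q (P.leftFace e) := by
    intro v hv
    induction hv with
    | refl => intro e he; exact hcyc _ _ he.symm
    | tail _ hs ih =>
      obtain ⟨e', h1, h2⟩ := hs
      intro e he
      rw [ih e' h1, hq, ← leftFace_rev]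
      exact hcyc _ _ (h2.trans he.symm)
  exact key _ (P.connected _ _) d' rfl

/-- A function on the vertices that does not change along any arc is constant. -/
theorem vertex_function_const {α : Type*} (p : V → α)
    (hp : ∀ d, p (P.tail d) = p (P.head d)) (u v : V) : p u = p v := by
  induction P.connected u v with
  | refl => rfl
  | tail _ hs ih =>
    obtain ⟨d, rfl, rfl⟩ := hs
    rw [ih, hp]; rfl

/-! ### Coboundaries on the sphere -/

theorem sum_antisymm_mul_coface {φ : D → ℚ} (hφ : ∀ d, φ (P.rev d) = -φ d) (q : P.Face → ℚ) :
    ∑ d, φ d * (q (P.leftFace d) - q (P.rightFace d)) = 2 * ∑ d, φ d * q (P.leftFace d) := by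
  -- Reversing all arcs flips the sign of `φ` and exchanges the two sides.
  have h : ∑ d, φ d * q (P.rightFace d) = -∑ d, φ d * q (P.leftFace d) := by
    rw [← Equiv.sum_comp P.rev, ← Finset.sum_neg_distrib]
    refine Finset.sum_congr rfl fun d _ => ?_
    rw [hφ, rightFace_rev]; ring
  simp only [mul_sub, Finset.sum_sub_distrib, h]
  ring

/-- The sum telescopes around each face: the head of an arc is the tail of the next arc on the same
face. -/
theorem sum_coboundary_mul_face (p : V → ℚ) (q : P.Face → ℚ) :
    ∑ d, (p (P.head d) - p (P.tail d)) * q (P.leftFace d) = 0 := by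
  have h : ∑ d, p (P.head d) * q (P.leftFace d) = ∑ d, p (P.tail d) * q (P.leftFace d) := by
    rw [← Equiv.sum_comp P.faceNext (fun d => p (P.tail d) * q (P.leftFace d))]
    simp only [tail_faceNext, leftFace_faceNext]
  simp only [sub_mul, Finset.sum_sub_distrib, h, sub_self]

/-- Vertex coboundaries are orthogonal to face coboundaries. -/
theorem sum_coboundary_mul_coface (p : V → ℚ) (q : P.Face → ℚ) :
    ∑ d, (p (P.head d) - p (P.tail d)) * (q (P.leftFace d) - q (P.rightFace d)) = 0 := by
  rw [P.sum_antisymm_mul_coface (fun d => by rw [head_rev, tail_rev]; ring),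
    sum_coboundary_mul_face, mul_zero]

/-- An orientation: a set of arcs that contains exactly one of each pair of antiparallel arcs. -/
theorem exists_orientation :
    ∃ O : Finset D, 2 * O.card = Fintype.card D ∧ ∀ d, d ∈ O ∨ P.rev d ∈ O := by
  classical
  let e := Fintype.equivFin D
  let O : Finset D := {d | e d < e (P.rev d)}
  have hlt : ∀ d, e d < e (P.rev d) ∨ e (P.rev d) < e d := fun d =>
    lt_or_gt_of_ne fun h => P.rev_ne d (e.injective h).symm
  refine ⟨O, ?_, fun d => ?_⟩
  · have hO : Oᶜ = O.map P.rev.toEmbedding := by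
      ext d
      simp only [O, Finset.mem_compl, Finset.mem_filter, Finset.mem_univ, true_and,
        Finset.mem_map, Equiv.coe_toEmbedding]
      constructor
      · intro h
        exact ⟨P.rev d, by rw [P.rev_rev]; exact (hlt d).resolve_left h, P.rev_rev d⟩
      · rintro ⟨d', h, rfl⟩
        rw [P.rev_rev]
        exact h.asymm
    have := Finset.card_add_card_compl O
    rw [hO, Finset.card_map] at this
    omega
  · simpa [O, P.rev_rev] using hlt d

/-- Every antisymmetric function on the arcs is the sum of a vertex coboundary and a face
coboundary. -/
theorem exists_coboundary_add_coface (d₀ : D) {φ : D → ℚ} (hφ : ∀ d, φ (P.rev d) = -φ d) :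
    ∃ (p : V → ℚ) (q : P.Face → ℚ), ∀ d,
      φ d = (p (P.head d) - p (P.tail d)) + (q (P.leftFace d) - q (P.rightFace d)) := by
  classical
  have : Fintype P.Face := Fintype.ofFinite _
  obtain ⟨O, hO, hrev⟩ := P.exists_orientation
  let T : ((V → ℚ) × (P.Face → ℚ)) →ₗ[ℚ] (O → ℚ) :=
    { toFun := fun x o => (x.1 (P.head o) - x.1 (P.tail o)) +
        (x.2 (P.leftFace o) - x.2 (P.rightFace o))
      map_add' := fun x y => by ext o; simp only [Prod.fst_add, Prod.snd_add, Pi.add_apply]; ring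
      map_smul' := fun a x => by
        ext o
        simp only [Prod.smul_fst, Prod.smul_snd, Pi.smul_apply, smul_eq_mul, RingHom.id_apply]
        ring }
  -- Only the constants on vertices and on faces are lost, so the values at one vertex and one face
  -- determine a kernel element.
  have hker : Module.finrank ℚ (LinearMap.ker T) ≤ 2 := by
    let ev : LinearMap.ker T →ₗ[ℚ] ℚ × ℚ :=
      { toFun := fun x => (x.1.1 (P.tail d₀), x.1.2 (P.leftFace d₀))
        map_add' := fun x y => rfl
        map_smul' := fun a x => rfl }
    have hev : Function.Injective ev := by
      rw [← LinearMap.ker_eq_bot, LinearMap.ker_eq_bot']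
      rintro ⟨⟨p, q⟩, hx⟩ h0
      simp only [ev, LinearMap.coe_mk, AddHom.coe_mk, Prod.mk_eq_zero] at h0
      have hT : ∀ d, (p (P.head d) - p (P.tail d)) +
          (q (P.leftFace d) - q (P.rightFace d)) = 0 := by
        have hx' : ∀ o : D, o ∈ O → (p (P.head o) - p (P.tail o)) +
            (q (P.leftFace o) - q (P.rightFace o)) = 0 := fun o ho => congrFun hx ⟨o, ho⟩
        intro d
        rcases hrev d with h | h
        · exact hx' d h
        · have := hx' _ h
          rw [head_rev, tail_rev, leftFace_rev, rightFace_rev] at this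
          linarith
      -- On the kernel the face coboundary is minus the vertex coboundary; orthogonality makes the
      -- latter orthogonal to itself.
      have hsq : ∑ d, (p (P.head d) - p (P.tail d)) ^ 2 = 0 := by
        have h := P.sum_coboundary_mul_coface p q
        rw [← neg_eq_zero, ← h, ← Finset.sum_neg_distrib]
        refine Finset.sum_congr rfl fun d _ => ?_
        have h2 : q (P.leftFace d) - q (P.rightFace d) = -(p (P.head d) - p (P.tail d)) := by
          linarith [hT d]
        rw [h2]; ring
      have hp : ∀ d, p (P.head d) - p (P.tail d) = 0 := fun d => by
        have := (Finset.sum_eq_zero_iff_of_nonneg fun d _ => sq_nonneg _).1 hsq d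
          (Finset.mem_univ d)
        exact pow_eq_zero_iff two_ne_zero |>.1 this
      have hp' := P.vertex_function_const p fun d => by linarith [hp d]
      have hq' := P.face_function_const q fun d => by linarith [hp d, hT d]
      ext v
      · exact (hp' v _).trans h0.1
      · exact (hq' v _).trans h0.2
    have := LinearMap.finrank_le_finrank_of_injective hev
    simpa using this
  -- By Euler's formula the rank is at least `|V| + |F| - 2 = |D| / 2`, the dimension of the target.
  have hsurj : Function.Surjective T := by
    rw [← LinearMap.range_eq_top]
    apply Submodule.eq_top_of_finrank_eq
    apply le_antisymm (Submodule.finrank_le _)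
    have h1 := LinearMap.finrank_range_add_finrank_ker T
    have h2 := P.euler
    have h3 : Nat.card (Quotient (Equiv.Perm.SameCycle.setoid (P.rot * P.rev)))
      = Fintype.card P.Face := Nat.card_eq_fintype_card (α := P.Face)
    simp only [Module.finrank_prod, Module.finrank_fintype_fun_eq_card, Fintype.card_coe] at h1 ⊢
    omega
  obtain ⟨⟨p, q⟩, hpq⟩ := hsurj fun o => φ o
  have hpq' : ∀ o : D, o ∈ O → (p (P.head o) - p (P.tail o)) +
      (q (P.leftFace o) - q (P.rightFace o)) = φ o := fun o ho => congrFun hpq ⟨o, ho⟩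
  refine ⟨p, q, fun d => ?_⟩
  rcases hrev d with h | h
  · exact (hpq' d h).symm
  · have := hpq' _ h
    rw [head_rev, tail_rev, leftFace_rev, rightFace_rev, hφ] at this
    linarith

/-! ### Dual chains and their potentials -/

/-- An antisymmetric function on the arcs, seen as a chain of dual arcs, whose boundary is that of
a dual walk from the face `f` to the face `f'`. -/
def IsDualChain (φ : D → ℚ) (f f' : P.Face) : Prop :=
  (∀ d, φ (P.rev d) = -φ d) ∧ ∀ q : P.Face → ℚ, ∑ d, φ d * q (P.leftFace d) = q f - q f'

variable {P}

theorem IsDualChain.add {φ ψ : D → ℚ} {f f' f'' : P.Face} (h : P.IsDualChain φ f f')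
    (h' : P.IsDualChain ψ f' f'') : P.IsDualChain (φ + ψ) f f'' := by
  refine ⟨fun d => ?_, fun q => ?_⟩
  · simp only [Pi.add_apply, h.1, h'.1]; ring
  · simp only [Pi.add_apply, add_mul, Finset.sum_add_distrib, h.2, h'.2]; ring

theorem isDualChain_zero (f : P.Face) : P.IsDualChain 0 f f := by
  refine ⟨fun d => ?_, fun q => ?_⟩ <;> simp

/-- On the sphere, a closed dual chain is a vertex coboundary. -/
theorem IsDualChain.exists_potential {φ : D → ℚ} {f : P.Face} (h : P.IsDualChain φ f f) :
    ∃ p : V → ℚ, ∀ d, φ d = p (P.head d) - p (P.tail d) := by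
  obtain ⟨d₀, -⟩ := P.exists_leftFace_eq f
  obtain ⟨p, q, hpq⟩ := P.exists_coboundary_add_coface d₀ h.1
  have hq0 : ∑ d, φ d * (q (P.leftFace d) - q (P.rightFace d)) = 0 := by
    rw [P.sum_antisymm_mul_coface h.1, h.2]; simp
  -- The closed chain and its vertex part are both orthogonal to the face part, which therefore
  -- vanishes.
  have hsq : ∑ d, (q (P.leftFace d) - q (P.rightFace d)) ^ 2 = 0 := by
    have h1 := P.sum_coboundary_mul_coface p q
    simp only [hpq, add_mul, Finset.sum_add_distrib, h1, zero_add] at hq0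
    simpa only [sq] using hq0
  refine ⟨p, fun d => ?_⟩
  have := (Finset.sum_eq_zero_iff_of_nonneg fun d _ => sq_nonneg _).1 hsq d (Finset.mem_univ d)
  rw [hpq, pow_eq_zero_iff two_ne_zero |>.1 this, add_zero]

variable (P)

/-- The vertex set `C` is connected (or empty). -/
def ConnSet (C : Set V) : Prop :=
  ∀ p : V → ℚ, (∀ d, P.tail d ∈ C → P.head d ∈ C → p (P.tail d) = p (P.head d)) →
    ∀ u ∈ C, ∀ v ∈ C, p u = p v

variable {P}

/-- Two connected sets that are joined by an edge have a connected union. -/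
theorem ConnSet.union {C C' : Set V} (h : P.ConnSet C) (h' : P.ConnSet C') (d : D)
    (hd : P.tail d ∈ C) (hd' : P.head d ∈ C') : P.ConnSet (C ∪ C') := by
  intro p hp
  have h1 := h p fun d a b => hp d (.inl a) (.inl b)
  have h2 := h' p fun d a b => hp d (.inr a) (.inr b)
  have h3 := hp d (.inl hd) (.inr hd')
  have h4 : ∀ u ∈ C ∪ C', p u = p (P.tail d) := by
    rintro u (hu | hu)
    · exact h1 u hu _ hd
    · rw [h3]; exact h2 u hu _ hd'
  intro u hu v hv
  rw [h4 u hu, h4 v hv]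

/-- A closed dual chain that does not cross the edges inside the connected sets `X` and `Y`
crosses all arcs from `X` to `Y` equally often. -/
theorem IsDualChain.eq_of_connSet {φ : D → ℚ} {f : P.Face} (h : P.IsDualChain φ f f)
    {X Y : Set V} (hX : P.ConnSet X) (hY : P.ConnSet Y)
    (hφX : ∀ d, P.tail d ∈ X → P.head d ∈ X → φ d = 0)
    (hφY : ∀ d, P.tail d ∈ Y → P.head d ∈ Y → φ d = 0) {d e : D}
    (hd : P.tail d ∈ X) (hd' : P.head d ∈ Y) (he : P.tail e ∈ X) (he' : P.head e ∈ Y) :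
    φ d = φ e := by
  obtain ⟨p, hp⟩ := h.exists_potential
  have h1 := hX p (fun d a b => by linarith [hp d, hφX d a b]) _ hd _ he
  have h2 := hY p (fun d a b => by linarith [hp d, hφY d a b]) _ hd' _ he'
  rw [hp, hp, h1, h2]

open Classical in
/-- The chain of a single dual arc. -/
noncomputable def dartChain (P : PlaneGraph V D) (e d : D) : ℚ :=
  (if d = e then 1 else 0) - (if d = P.rev e then 1 else 0)

theorem isDualChain_dartChain (e : D) :
    P.IsDualChain (P.dartChain e) (P.leftFace e) (P.rightFace e) := by
  classical
  refine ⟨fun d => ?_, fun q => ?_⟩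
  · have h1 : P.rev d = e ↔ d = P.rev e :=
      ⟨fun h => by rw [← h, P.rev_rev], fun h => by rw [h, P.rev_rev]⟩
    have h2 : P.rev d = P.rev e ↔ d = e := P.rev.apply_eq_iff_eq
    rw [dartChain, dartChain, if_congr h1 rfl rfl, if_congr h2 rfl rfl, neg_sub]
  · simp [dartChain, sub_mul, ite_mul, Finset.sum_sub_distrib, leftFace_rev]

/-- The chain of the `k` dual arcs `c 0, …, c (k - 1)`. -/
noncomputable def pathChain (P : PlaneGraph V D) (c : ℕ → D) (k : ℕ) : D → ℚ :=
  ∑ t ∈ Finset.range k, P.dartChain (c t)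

theorem isDualChain_pathChain {c : ℕ → D} (hc : ∀ t, P.rightFace (c t) = P.leftFace (c (t + 1)))
    (k : ℕ) : P.IsDualChain (P.pathChain c k) (P.leftFace (c 0)) (P.leftFace (c k)) := by
  induction k with
  | zero => simpa [pathChain] using isDualChain_zero _
  | succ k ih =>
    rw [pathChain, Finset.sum_range_succ]
    exact ih.add (hc k ▸ isDualChain_dartChain (c k))

/-! ### Bonds as simple dual cycles -/

variable (P)

/-- The arcs that leave the vertex set `X`. -/
def cut (X : Set V) : Set D := {d | P.tail d ∈ X ∧ P.head d ∉ X}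

variable {P}

theorem rev_notMem_cut {X : Set V} {d : D} (h : d ∈ P.cut X) : P.rev d ∉ P.cut X :=
  fun h' => h.2 h'.1

theorem pathChain_eq_zero_of_notMem_cut {X : Set V} {c : ℕ → D} (hc : ∀ t, c t ∈ P.cut X) (k : ℕ)
    {d : D} (h : d ∉ P.cut X) (h' : P.rev d ∉ P.cut X) : P.pathChain c k d = 0 := by
  rw [pathChain, Finset.sum_apply]
  refine Finset.sum_eq_zero fun t _ => ?_
  rw [dartChain, if_neg, if_neg, sub_zero]
  · rintro rfl; exact h' (by rw [P.rev_rev]; exact hc t)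
  · rintro rfl; exact h (hc t)

/-- All arcs of the path leave `X`, so no traversals cancel: on the cut the chain counts how often
an arc occurs. -/
theorem pathChain_eq_zero_iff {X : Set V} {c : ℕ → D} (hc : ∀ t, c t ∈ P.cut X) (k : ℕ)
    {d : D} (h : d ∈ P.cut X) : P.pathChain c k d = 0 ↔ ∀ t < k, d ≠ c t := by
  classical
  have h1 : P.pathChain c k d = ∑ t ∈ Finset.range k, if d = c t then 1 else 0 := by
    rw [pathChain, Finset.sum_apply]
    refine Finset.sum_congr rfl fun t _ => ?_
    have : d ≠ P.rev (c t) := by rintro rfl; exact rev_notMem_cut (hc t) h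
    simp [dartChain, this]
  rw [h1, Finset.sum_eq_zero_iff_of_nonneg fun t _ => by split_ifs <;> norm_num]
  simp

/-- If the boundary of a face meets both `X` and its complement, then it leaves `X` somewhere. -/
theorem exists_mem_cut_leftFace {X : Set V} {f : P.Face} {u v : V} (hu : P.Incident f u)
    (huX : u ∈ X) (hv : P.Incident f v) (hvX : v ∉ X) : ∃ e ∈ P.cut X, P.leftFace e = f := by
  obtain ⟨d, rfl, rfl⟩ := hu
  obtain ⟨d', hd', rfl⟩ := hv
  by_contra! hne
  classical
  obtain ⟨k, -, -, hk⟩ := ((P.leftFace_eq_iff _ _).1 hd'.symm).exists_pow_eq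
  have key : ∀ k : ℕ, P.leftFace ((P.faceNext ^ k) d) = P.leftFace d ∧
      P.tail ((P.faceNext ^ k) d) ∈ X := by
    intro k
    induction k with
    | zero => exact ⟨rfl, huX⟩
    | succ k ih =>
      rw [pow_succ', Equiv.Perm.mul_apply, leftFace_faceNext, tail_faceNext]
      refine ⟨ih.1, ?_⟩
      by_contra h
      exact hne _ ⟨ih.2, h⟩ ih.1
  exact hvX (hk ▸ (key k).2)

/-- The chain of the path is constant on the cut and nonzero at `c 0`, so a closed path inside a
bond uses every arc of it. -/
theorem mem_cut_eq_of_closed_path {X : Set V} (hX : P.ConnSet X) (hX' : P.ConnSet Xᶜ)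
    {c : ℕ → D} (hc : ∀ t, c t ∈ P.cut X) (hn : ∀ t, P.rightFace (c t) = P.leftFace (c (t + 1)))
    {k : ℕ} (hk : 0 < k) (hclosed : P.leftFace (c k) = P.leftFace (c 0)) {d : D}
    (hd : d ∈ P.cut X) : ∃ t < k, d = c t := by
  have h := isDualChain_pathChain hn k
  rw [hclosed] at h
  have hz : ∀ d, d ∉ P.cut X → P.rev d ∉ P.cut X → P.pathChain c k d = 0 :=
    fun d => pathChain_eq_zero_of_notMem_cut hc k
  have h1 : P.pathChain c k d = P.pathChain c k (c 0) :=
    h.eq_of_connSet hX hX' (fun d a b => hz d (fun h => h.2 b) (fun h => h.2 (by rwa [head_rev])))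
      (fun d a b => hz d (fun h => a h.1) (fun h => b h.1)) hd.1 hd.2 (hc 0).1 (hc 0).2
  by_contra! hne
  rw [(pathChain_eq_zero_iff hc k hd).2 hne, eq_comm, pathChain_eq_zero_iff hc k (hc 0)] at h1
  exact h1 0 hk rfl

/-- The duals of the arcs of a non-empty bond form a simple dual cycle. -/
theorem exists_isSimpleDualCycle_cut {X : Set V} (hX : P.ConnSet X) (hX' : P.ConnSet Xᶜ)
    (hne : (P.cut X).Nonempty) :
    ∃ (n : ℕ) (c : ZMod n → D), n ≠ 0 ∧ P.IsSimpleDualCycle c (P.cut X) := by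
  have hnext : ∀ d : P.cut X, ∃ e : P.cut X, P.leftFace e = P.rightFace d := by
    rintro ⟨d, hd⟩
    obtain ⟨e, he, h⟩ := exists_mem_cut_leftFace (P.incident_right_tail d) hd.1
      (P.incident_right_head d) hd.2
    exact ⟨⟨e, he⟩, h⟩
  obtain ⟨d₀, hd₀⟩ := hne
  choose N hN using hnext
  let c₀ : ℕ → P.cut X := fun t => N^[t] ⟨d₀, hd₀⟩
  have hc₀ : ∀ t, P.rightFace (c₀ t) = P.leftFace (c₀ (t + 1)) := fun t => by
    simp only [c₀, Function.iterate_succ_apply', hN]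
  -- The shortest return over all starting points is taken; minimality then separates all faces
  -- within one period. The start `i` is free because the orbit of `N` is only known to be
  -- eventually periodic.
  have hex : ∃ k, 0 < k ∧ ∃ i, P.leftFace (c₀ (i + k)) = P.leftFace (c₀ i) := by
    obtain ⟨i, j, hij, h⟩ := Finite.exists_ne_map_eq_of_infinite fun t => P.leftFace (c₀ t).1
    rcases lt_or_gt_of_ne hij with h' | h'
    · exact ⟨j - i, by omega, i, by rw [Nat.add_sub_cancel' h'.le]; exact h.symm⟩
    · exact ⟨i - j, by omega, j, by rw [Nat.add_sub_cancel' h'.le]; exact h⟩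
  classical
  obtain ⟨hn, i, hi⟩ := Nat.find_spec hex
  set n := Nat.find hex with hndef
  have hmin : ∀ k < n, 0 < k → ∀ i, P.leftFace (c₀ (i + k)) ≠ P.leftFace (c₀ i) :=
    fun k hk h0 i h => Nat.find_min hex hk ⟨h0, i, h⟩
  have : NeZero n := ⟨hn.ne'⟩
  refine ⟨n, fun z => c₀ (i + z.val), hn.ne', ?_, fun z => ?_, fun z z' h => ?_⟩
  · ext d
    constructor
    · rintro ⟨z, rfl⟩
      exact (c₀ _).2
    · intro hd
      obtain ⟨t, ht, rfl⟩ := mem_cut_eq_of_closed_path hX hX' (c := fun t => c₀ (i + t))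
        (fun t => (c₀ _).2) (fun t => hc₀ (i + t)) hn hi hd
      exact ⟨t, by simp only [ZMod.val_natCast, Nat.mod_eq_of_lt ht]⟩
  · rw [hc₀]
    rcases Nat.lt_or_ge (z.val + 1) n with h | h
    · have : (z + 1).val = z.val + 1 := by
        have h2 : ((z.val + 1 : ℕ) : ZMod n) = z + 1 := by simp
        rw [← h2, ZMod.val_natCast, Nat.mod_eq_of_lt h]
      simp only [this, add_assoc]
    -- At the last index the cycle closes up, by the return `hi`.
    · have hz : z.val + 1 = n := le_antisymm (ZMod.val_lt z) h
      have : z + 1 = 0 := by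
        have h2 : ((z.val + 1 : ℕ) : ZMod n) = 0 := by rw [hz]; simp
        simpa using h2
      rw [this, add_assoc, hz, hi]
      simp only [ZMod.val_zero, add_zero]
  · by_contra hzz
    have hv : z.val ≠ z'.val := fun h => hzz (ZMod.val_injective n h)
    have h1 := ZMod.val_lt z
    have h2 := ZMod.val_lt z'
    rcases lt_or_gt_of_ne hv with h' | h'
    · refine hmin (z'.val - z.val) (by omega) (by omega) (i + z.val) ?_
      rw [show i + z.val + (z'.val - z.val) = i + z'.val by omega]
      exact h.symm
    · refine hmin (z.val - z'.val) (by omega) (by omega) (i + z'.val) ?_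
      rw [show i + z'.val + (z.val - z'.val) = i + z.val by omega]
      exact h

end PlaneGraph

/-! ### Walks and distances -/

namespace PlaneGraph

variable {V D : Type*} [Fintype V] [Fintype D] {P : PlaneGraph V D}

theorem isWalk_append {u w : V} {p q : List D} :
    P.IsWalk u (p ++ q) w ↔ ∃ v, P.IsWalk u p v ∧ P.IsWalk v q w := by
  induction p generalizing u with
  | nil => simp [IsWalk]
  | cons d p ih => simp [IsWalk, ih, and_assoc]

theorem IsWalk.end_unique {u v w : V} {p : List D} (h : P.IsWalk u p v) (h' : P.IsWalk u p w) :
    v = w := by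
  induction p generalizing u with
  | nil => exact h.symm.trans h'
  | cons d p ih => exact ih h.2 h'.2

omit [Fintype D] in
theorem walkLength_append (ℓ : D → WithTop ℝ) (p q : List D) :
    walkLength ℓ (p ++ q) = walkLength ℓ p + walkLength ℓ q := by
  simp [walkLength]

omit [Fintype D] in
theorem walkLength_cons (ℓ : D → WithTop ℝ) (d : D) (p : List D) :
    walkLength ℓ (d :: p) = ℓ d + walkLength ℓ p := by
  simp [walkLength]

/-- Without negative cycles, every walk can be replaced by one that is no longer and has at most
as many arcs as there are vertices. -/
theorem exists_short_walk {ℓ : D → WithTop ℝ} (hℓ : P.NoNegativeCycle ℓ) {u v : V} (p : List D)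
    (hp : P.IsWalk u p v) :
    ∃ q, P.IsWalk u q v ∧ q.length ≤ Fintype.card V ∧ walkLength ℓ q ≤ walkLength ℓ p := by
  induction hn : p.length using Nat.strong_induction_on generalizing p with
  | _ n ih =>
  subst hn
  rcases Nat.lt_or_ge (Fintype.card V) p.length with h | h
  swap
  · exact ⟨p, hp, h, le_rfl⟩
  -- Among the ends of the prefixes of length `0, …, |V|` two coincide; the closed walk between them
  -- has nonnegative length and is removed.
  have hsplit : ∀ i : Fin (Fintype.card V + 1), ∃ x, P.IsWalk u (p.take i) x ∧
      P.IsWalk x (p.drop i) v := fun i => by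
    rw [← isWalk_append, List.take_append_drop]; exact hp
  choose x hx hx' using hsplit
  obtain ⟨i, j, hij, hxij⟩ := Fintype.exists_ne_map_eq_of_card_lt x (by simp)
  wlog hlt : i < j generalizing i j
  · exact this j i hij.symm hxij.symm (lt_of_le_of_ne (not_lt.1 hlt) hij.symm)
  have hlt' : (i : ℕ) < j := hlt
  have htake : p.take j = p.take i ++ (p.take j).drop i := by
    conv_lhs => rw [← List.take_append_drop i (p.take j)]
    rw [List.take_take, min_eq_left hlt'.le]
  have hmid : P.IsWalk (x i) ((p.take j).drop i) (x i) := by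
    have h1 := hx j
    rw [htake, isWalk_append] at h1
    obtain ⟨y, hy, hy'⟩ := h1
    rwa [hy.end_unique (hx i), ← hxij] at hy'
  have hlen : (p.take i ++ p.drop j).length < p.length := by
    simp only [List.length_append, List.length_take, List.length_drop]
    have := j.2
    omega
  obtain ⟨q, hq, hq', hql⟩ := ih _ hlen _ (isWalk_append.2 ⟨x i, hx i, hxij ▸ hx' j⟩) rfl
  refine ⟨q, hq, hq', hql.trans ?_⟩
  conv_rhs => rw [← List.take_append_drop j p, htake]
  rw [walkLength_append, walkLength_append, walkLength_append]
  gcongr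
  exact le_add_of_nonneg_right (hℓ _ _ hmid)

/-- Short walks suffice, and there are finitely many of them. The default `0` for infinite length
adds one harmless value to the finite set being bounded. -/
theorem bddBelow_walkLength {ℓ : D → WithTop ℝ} (hℓ : P.NoNegativeCycle ℓ) (u v : V) :
    BddBelow {a : ℝ | ∃ p, P.IsWalk u p v ∧ walkLength ℓ p = (a : WithTop ℝ)} := by
  obtain ⟨m, hm⟩ := ((List.finite_length_le D (Fintype.card V)).image
    fun p => (walkLength ℓ p).untopD 0).bddBelow
  refine ⟨m, ?_⟩
  rintro a ⟨p, hp, ha⟩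
  obtain ⟨q, -, hq, hle⟩ := exists_short_walk hℓ p hp
  rw [ha] at hle
  obtain ⟨b, hb⟩ := WithTop.ne_top_iff_exists.1 (ne_top_of_le_ne_top WithTop.coe_ne_top hle)
  have h1 := hm ⟨q, hq, rfl⟩
  simp only [← hb, WithTop.untopD_coe] at h1
  rw [← hb, WithTop.coe_le_coe] at hle
  exact h1.trans hle

theorem dist_le {ℓ : D → WithTop ℝ} (hℓ : P.NoNegativeCycle ℓ) {u v : V} {p : List D}
    (hp : P.IsWalk u p v) {a : ℝ} (ha : walkLength ℓ p = a) : P.dist ℓ u v ≤ a :=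
  csInf_le (bddBelow_walkLength hℓ u v) ⟨p, hp, ha⟩

/-- Approximating the infimum is enough throughout; no shortest walk has to be produced. -/
theorem exists_walk_lt {ℓ : D → WithTop ℝ} {u v : V} (h : P.FinitelyReachable ℓ u v) {c : ℝ}
    (hc : P.dist ℓ u v < c) :
    ∃ (p : List D) (a : ℝ), P.IsWalk u p v ∧ walkLength ℓ p = a ∧ a < c := by
  obtain ⟨p, hp, hp'⟩ := h
  obtain ⟨b, hb⟩ := WithTop.ne_top_iff_exists.1 hp'
  obtain ⟨a, ⟨q, hq, ha⟩, hac⟩ := exists_lt_of_csInf_lt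
    (s := {a : ℝ | ∃ p, P.IsWalk u p v ∧ walkLength ℓ p = (a : WithTop ℝ)})
    ⟨b, p, hp, hb.symm⟩ hc
  exact ⟨q, a, hq, ha, hac⟩

/-! ### Potentials and connectedness of cells -/

variable (P)

/-- The function `h` grows along each arc by at most the length of the arc. -/
def IsPotential (ℓ : D → WithTop ℝ) (h : V → ℝ) : Prop :=
  ∀ (d : D) (a : ℝ), ℓ d = a → h (P.head d) ≤ h (P.tail d) + a

variable {P}

theorem isPotential_dist {ℓ : D → WithTop ℝ} (hℓ : P.NoNegativeCycle ℓ) {s : V}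
    (hs : ∀ v, P.FinitelyReachable ℓ s v) (w : ℝ) :
    P.IsPotential ℓ fun v => w + P.dist ℓ s v := by
  intro d a ha
  by_contra! h
  obtain ⟨p, b, hp, hb, hlt⟩ := exists_walk_lt (hs (P.tail d))
    (c := P.dist ℓ s (P.head d) - a) (by linarith)
  have h1 := dist_le hℓ (p := p ++ [d]) (a := b + a)
    (isWalk_append.2 ⟨_, hp, rfl, rfl⟩) (by
      rw [walkLength_append, hb, walkLength_cons, ha]; simp [walkLength])
  linarith

theorem IsPotential.min {ℓ : D → WithTop ℝ} {h h' : V → ℝ} (hh : P.IsPotential ℓ h)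
    (hh' : P.IsPotential ℓ h') : P.IsPotential ℓ fun v => min (h v) (h' v) := by
  intro d a ha
  rw [← min_add_add_right]
  exact min_le_min (hh d a ha) (hh' d a ha)

/-- The cell of a site, against a potential that plays the role of the other sites, is
connected. -/
theorem connSet_cell {ℓ : D → WithTop ℝ} (hℓ : P.NoNegativeCycle ℓ) {s : V}
    (hs : ∀ v, P.FinitelyReachable ℓ s v) (w : ℝ) {h : V → ℝ} (hh : P.IsPotential ℓ h) :
    P.ConnSet {v | w + P.dist ℓ s v < h v} ∧
      ∀ v, w + P.dist ℓ s v < h v → w + P.dist ℓ s s < h s := by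
  have hds : P.dist ℓ s s ≤ 0 := dist_le hℓ (p := []) rfl rfl
  have walk : ∀ v, w + P.dist ℓ s v < h v → ∃ (p : List D) (c : ℝ), P.IsWalk s p v ∧
      walkLength ℓ p = c ∧ w + 0 + c < h v := fun v hv => by
    obtain ⟨p, c, hp, hc, hlt⟩ := exists_walk_lt (hs v) (c := h v - w) (by linarith)
    exact ⟨p, c, hp, hc, by linarith⟩
  -- Here `A` bounds the distance from `s` to the current vertex `u`, and `c` is the length still to
  -- go. Since `h` grows along an arc by at most its length, the strict inequality at `v` passes
  -- back to every vertex of the walk.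
  have key : ∀ (v : V) (p : List D) (u : V) (A c : ℝ), P.IsWalk u p v → walkLength ℓ p = c →
      P.dist ℓ s u ≤ A → w + A + c < h v → w + A < h u ∧ ∀ f : V → ℚ,
        (∀ d, w + P.dist ℓ s (P.tail d) < h (P.tail d) →
          w + P.dist ℓ s (P.head d) < h (P.head d) → f (P.tail d) = f (P.head d)) →
        f u = f v := by
    intro v p
    induction p with
    | nil =>
      rintro u A c rfl hc hA hlt
      have hc0 : c = 0 := by
        have : ((0 : ℝ) : WithTop ℝ) = c := hc
        exact (WithTop.coe_injective this).symm
      subst hc0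
      exact ⟨by linarith, fun f _ => rfl⟩
    | cons d p ih =>
      rintro u A c ⟨rfl, hp⟩ hc hA hlt
      rw [walkLength_cons] at hc
      obtain ⟨a, b, ha, hb, hab⟩ := WithTop.add_eq_coe.1 hc
      have hd : P.dist ℓ s (P.head d) ≤ A + a := by
        have := isPotential_dist hℓ hs 0 d a ha.symm
        simp only [zero_add] at this
        linarith
      obtain ⟨h1, h2⟩ := ih (P.head d) (A + a) b hp hb.symm hd (by linarith)
      have h3 := hh d a ha.symm
      have h4 : w + A < h (P.tail d) := by linarith
      exact ⟨h4, fun f hf => (hf d (by linarith) (by linarith)).trans (h2 f hf)⟩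
  constructor
  · intro f hf
    have hfs : ∀ v, w + P.dist ℓ s v < h v → f s = f v := fun v hv => by
      obtain ⟨p, c, hp, hc, hlt⟩ := walk v hv
      exact (key v p s 0 c hp hc hds hlt).2 f hf
    intro u hu v hv
    rw [← hfs u hu, hfs v hv]
  · intro v hv
    obtain ⟨p, c, hp, hc, hlt⟩ := walk v hv
    linarith [(key v p s 0 c hp hc hds hlt).1]

end PlaneGraph

/-! ### Cyclic sequences with interval superlevel sets -/

/-- A cyclic interval is not left and entered again twice on the way around. -/
theorem ZMod.not_alternating_interval {n : ℕ} {s z : ZMod n} {m : ℕ} (hm : m ≤ n)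
    {S : ZMod n → Prop} (hS : ∀ j, S j ↔ ∃ t < m, j = s + (t : ZMod n)) {u₁ u₂ u₃ : ℕ}
    (h₁₂ : u₁ < u₂) (h₂₃ : u₂ < u₃) (h₃ : u₃ < n) (hz : S z)
    (hz₁ : ¬S (z + (u₁ : ZMod n))) (hz₂ : S (z + (u₂ : ZMod n))) :
    S (z + (u₃ : ZMod n)) := by
  rw [hS] at *
  obtain ⟨p, hp, rfl⟩ := hz
  obtain ⟨t, ht, h⟩ := hz₂
  rw [add_assoc, add_right_inj, ← Nat.cast_add, ZMod.natCast_eq_natCast_iff] at h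
  have h1 : ¬p + u₁ < m := fun h => hz₁ ⟨p + u₁, h, by push_cast; ring⟩
  -- The interval can be met again only after wrapping past its start, and then it lasts at least
  -- until `z` recurs.
  have h2 : n ≤ p + u₂ := by
    by_contra! h3
    rw [Nat.ModEq, Nat.mod_eq_of_lt h3, Nat.mod_eq_of_lt (by omega)] at h
    omega
  refine ⟨p + u₃ - n, by omega, ?_⟩
  rw [Nat.cast_sub (by omega)]
  push_cast
  simp only [CharP.cast_eq_zero, sub_zero]
  ring

/-- A cyclic sequence whose superlevel sets are cyclic intervals is weakly bitonic. -/
theorem isCyclicallyWeaklyBitonic_of_superlevel {n : ℕ} (hn : n ≠ 0) (a : ZMod n → ℝ)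
    (h : ∀ x, ∃ (s : ZMod n) (m : ℕ), m ≤ n ∧ ∀ j, x ≤ a j ↔ ∃ t < m, j = s + (t : ZMod n)) :
    IsCyclicallyWeaklyBitonic a := by
  have : NeZero n := ⟨hn⟩
  -- The sequence is cut at a maximum, and the turning point is a minimum. A violation of
  -- monotonicity would make some superlevel set leave, re-enter, and then contain the minimum.
  obtain ⟨s₀, hmax⟩ := Finite.exists_max a
  obtain ⟨j₀, hmin⟩ := Finite.exists_min a
  have hk : s₀ + ((j₀ - s₀).val : ZMod n) = j₀ := by
    rw [ZMod.natCast_zmod_val]; ring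
  set k := (j₀ - s₀).val with hkdef
  have hkn : k < n := ZMod.val_lt _
  refine ⟨s₀, k, hkn.le, ?_, ?_⟩
  · rintro t ⟨-, ht⟩ t' ⟨-, ht'⟩ htt'
    by_contra! hlt
    obtain ⟨s, m, hm, hS⟩ := h (a (s₀ + (t' : ZMod n)))
    have ht0 : t ≠ t' := by rintro rfl; exact lt_irrefl _ hlt
    have hk' : t' ≠ k := by
      rintro h'
      rw [h', hk] at hlt
      exact (hmin _).not_gt hlt
    have := ZMod.not_alternating_interval hm (S := fun j => a (s₀ + (t' : ZMod n)) ≤ a j) hS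
      (z := s₀) (u₁ := t) (u₂ := t') (u₃ := k) (by omega) (by omega) hkn (hmax _) hlt.not_ge le_rfl
    rw [hk] at this
    exact ((hmin _).trans_lt hlt).not_ge this
  · rintro t ⟨ht, -⟩ t' ⟨-, ht'⟩ htt'
    by_contra! hlt
    obtain ⟨s, m, hm, hS⟩ := h (a (s₀ + (t : ZMod n)))
    have ht0 : t ≠ t' := by rintro rfl; exact lt_irrefl _ hlt
    have htk : t ≠ k := by
      rintro h'
      rw [h', hk] at hlt
      exact (hmin _).not_gt hlt
    have hk0 : k ≠ 0 := by
      intro h'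
      rw [h', Nat.cast_zero, add_zero] at hk
      exact ((hmax _).trans (hk ▸ hmin _)).not_gt hlt
    have htn : t' ≠ n := by
      rintro h'
      rw [h'] at hlt
      simp only [CharP.cast_eq_zero, add_zero] at hlt
      exact (hmax _).not_gt hlt
    have e1 : s₀ + (t : ZMod n) + ((t' - t : ℕ) : ZMod n) = s₀ + (t' : ZMod n) := by
      rw [Nat.cast_sub (by omega)]; ring
    have e2 : s₀ + (t : ZMod n) + ((n - t : ℕ) : ZMod n) = s₀ := by
      rw [Nat.cast_sub (by omega)]; simp
    have e3 : s₀ + (t : ZMod n) + ((n + k - t : ℕ) : ZMod n) = j₀ := by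
      rw [Nat.cast_sub (by omega), ← hk]; push_cast; simp only [CharP.cast_eq_zero]; ring
    have := ZMod.not_alternating_interval hm (S := fun j => a (s₀ + (t : ZMod n)) ≤ a j) hS
      (z := s₀ + (t : ZMod n)) (u₁ := t' - t) (u₂ := n - t) (u₃ := n + k - t) (by omega)
      (by omega) (by omega) le_rfl (by rw [e1]; exact hlt.not_ge) (by rw [e2]; exact hmax _)
    rw [e3] at this
    exact ((hmin _).trans_lt hlt).not_ge this

/-- If, in addition, `s₀` is an end of each proper superlevel set, then the sequence read from
`s₀` is weakly monotone. -/
theorem monotoneOn_or_antitoneOn_of_superlevel {n : ℕ} (hn : n ≠ 0) (a : ZMod n → ℝ)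
    (h : ∀ x, ∃ (s : ZMod n) (m : ℕ), m ≤ n ∧ ∀ j, x ≤ a j ↔ ∃ t < m, j = s + (t : ZMod n))
    (s₀ : ZMod n)
    (hs₀ : ∀ x, (∃ j, x ≤ a j) → (∃ j, ¬x ≤ a j) → (x ≤ a s₀ ↔ ¬x ≤ a (s₀ - 1))) :
    MonotoneOn (fun t : ℕ => a (s₀ + (t : ZMod n))) (Set.Iio n) ∨
      AntitoneOn (fun t : ℕ => a (s₀ + (t : ZMod n))) (Set.Iio n) := by
  have elast : s₀ + ((n - 1 : ℕ) : ZMod n) = s₀ - 1 := by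
    rw [Nat.cast_sub (by omega)]; simp; ring
  rcases lt_or_ge (a s₀) (a (s₀ - 1)) with hcmp | hcmp
  · left
    intro t ht t' ht' htt'
    simp only [Set.mem_Iio] at ht ht'
    by_contra! hlt
    obtain ⟨s, m, hm, hS⟩ := h (a (s₀ + (t : ZMod n)))
    have hx := hs₀ _ ⟨_, le_rfl⟩ ⟨_, hlt.not_ge⟩
    -- Exactly one of `s₀` and `s₀ - 1` lies in the superlevel set; it must be the one with the
    -- larger value.
    have h0 : ¬a (s₀ + (t : ZMod n)) ≤ a s₀ := fun h' => hx.1 h' (h'.trans hcmp.le)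
    have h1 : a (s₀ + (t : ZMod n)) ≤ a (s₀ - 1) := by
      by_contra h'; exact h0 (hx.2 h')
    have ht0 : t ≠ t' := by rintro rfl; exact lt_irrefl _ hlt
    have ht1 : t ≠ 0 := by rintro rfl; simp at h0
    have ht2 : t' ≠ n - 1 := by rintro rfl; rw [elast] at hlt; exact hlt.not_ge h1
    have e1 : s₀ + (t : ZMod n) + ((t' - t : ℕ) : ZMod n) = s₀ + (t' : ZMod n) := by
      rw [Nat.cast_sub (by omega)]; ring
    have e2 : s₀ + (t : ZMod n) + ((n - 1 - t : ℕ) : ZMod n) = s₀ - 1 := by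
      rw [← elast, Nat.cast_sub (show t ≤ n - 1 by omega)]; ring
    have e3 : s₀ + (t : ZMod n) + ((n - t : ℕ) : ZMod n) = s₀ := by
      rw [Nat.cast_sub (by omega)]; simp
    have := ZMod.not_alternating_interval hm (S := fun j => a (s₀ + (t : ZMod n)) ≤ a j) hS
      (z := s₀ + (t : ZMod n)) (u₁ := t' - t) (u₂ := n - 1 - t) (u₃ := n - t) (by omega)
      (by omega) (by omega) le_rfl (by rw [e1]; exact hlt.not_ge) (by rw [e2]; exact h1)
    rw [e3] at this
    exact h0 this
  · right
    intro t ht t' ht' htt'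
    simp only [Set.mem_Iio] at ht ht'
    by_contra! hlt
    obtain ⟨s, m, hm, hS⟩ := h (a (s₀ + (t' : ZMod n)))
    have hx := hs₀ _ ⟨_, le_rfl⟩ ⟨_, hlt.not_ge⟩
    have h1 : ¬a (s₀ + (t' : ZMod n)) ≤ a (s₀ - 1) := fun h' => hx.1 (h'.trans hcmp) h'
    have h0 := hx.2 h1
    have ht0 : t ≠ t' := by rintro rfl; exact lt_irrefl _ hlt
    have ht1 : t ≠ 0 := by
      rintro rfl
      simp only [Nat.cast_zero, add_zero] at hlt
      exact hlt.not_ge h0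
    have ht2 : t' ≠ n - 1 := by rintro rfl; rw [elast] at h1; exact h1 le_rfl
    have := ZMod.not_alternating_interval hm (S := fun j => a (s₀ + (t' : ZMod n)) ≤ a j) hS
      (z := s₀) (u₁ := t) (u₂ := t') (u₃ := n - 1) (by omega)
      (by omega) (by omega) h0 hlt.not_ge le_rfl
    rw [elast] at this
    exact h1 this

/-- A subset of a cycle that is neither empty nor full has a point where it is left. -/
theorem ZMod.exists_mem_sub_one_notMem {n : ℕ} (hn : n ≠ 0) {q : ZMod n → Prop} {z z' : ZMod n}
    (hz : q z) (hz' : ¬q z') : ∃ i, q (i - 1) ∧ ¬q i := by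
  have : NeZero n := ⟨hn⟩
  by_contra! h
  have key : ∀ t : ℕ, ¬q (z' - (t : ZMod n)) := by
    intro t
    induction t with
    | zero => simpa using hz'
    | succ t ih =>
      intro h'
      refine ih (h _ ?_)
      convert h' using 1
      push_cast; ring
  apply key (z' - z).val
  rw [ZMod.natCast_zmod_val]
  simpa using hz

/-! ### A third cell along a bond -/

namespace PlaneGraph

variable {V D : Type*} [Fintype V] [Fintype D] {P : PlaneGraph V D}

/-- The simple dual cycle formed by the bond leaves each face at most once. -/
theorem eq_of_mem_cut_of_leftFace_eq {X : Set V} (hX : P.ConnSet X) (hX' : P.ConnSet Xᶜ) {d e : D}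
    (hd : d ∈ P.cut X) (he : e ∈ P.cut X) (h : P.leftFace d = P.leftFace e) : d = e := by
  obtain ⟨n, c, hn, hc, -, hinj⟩ := exists_isSimpleDualCycle_cut hX hX' ⟨d, hd⟩
  rw [← hc] at hd he
  obtain ⟨i, rfl⟩ := hd
  obtain ⟨j, rfl⟩ := he
  rw [hinj h]

/-- Two faces that meet both `X` and its complement are joined by a dual path along the boundary
of `X`. -/
theorem exists_isDualChain_along_cut {X : Set V} (hX : P.ConnSet X) (hX' : P.ConnSet Xᶜ)
    {f f' : P.Face} (hf : ∃ v ∈ X, P.Incident f v) (hf₁ : ∃ v ∉ X, P.Incident f v)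
    (hf' : ∃ v ∈ X, P.Incident f' v) (hf₁' : ∃ v ∉ X, P.Incident f' v) :
    ∃ ψ : D → ℚ, P.IsDualChain ψ f f' ∧
      ∀ d, P.tail d ∉ X → P.head d ∉ X → ψ d = 0 := by
  obtain ⟨u, hu, hfu⟩ := hf
  obtain ⟨v, hv, hfv⟩ := hf₁
  obtain ⟨u', hu', hfu'⟩ := hf'
  obtain ⟨v', hv', hfv'⟩ := hf₁'
  obtain ⟨e, he, rfl⟩ := exists_mem_cut_leftFace hfu hu hfv hv
  obtain ⟨e', he', rfl⟩ := exists_mem_cut_leftFace hfu' hu' hfv' hv'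
  obtain ⟨n, c, hn, hc, hnext, -⟩ := exists_isSimpleDualCycle_cut hX hX' ⟨e, he⟩
  have : NeZero n := ⟨hn⟩
  have hcm : ∀ z, c z ∈ P.cut X := fun z => hc ▸ ⟨z, rfl⟩
  rw [← hc] at he he'
  obtain ⟨i, rfl⟩ := he
  obtain ⟨j, rfl⟩ := he'
  have h := isDualChain_pathChain (P := P) (c := fun t : ℕ => c (i + (t : ZMod n)))
    (fun t => by rw [hnext]; push_cast; rw [add_assoc]) (j - i).val
  simp only [Nat.cast_zero, add_zero, ZMod.natCast_zmod_val, add_sub_cancel] at h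
  exact ⟨_, h, fun d hd hd' => pathChain_eq_zero_of_notMem_cut (fun t => hcm _) _
    (fun h => hd h.1) (fun h => hd' h.1)⟩

/-- A segment of the bisector cycle of `G` that starts and ends at faces on the boundary of `R`
contains either all or none of the arcs that avoid `R`. -/
theorem mem_segment_of_mem_segment {G R : Set V} (hR : P.ConnSet R) (hR' : P.ConnSet Rᶜ)
    (hGR : P.ConnSet (G \ R)) (hBR : P.ConnSet (Gᶜ \ R)) {c : ℕ → D}
    (hc : ∀ t, c t ∈ P.cut G) (hnext : ∀ t, P.rightFace (c t) = P.leftFace (c (t + 1))) {k : ℕ}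
    (h₀ : ∃ v ∈ R, P.Incident (P.leftFace (c 0)) v) (h₀' : ∃ v ∉ R, P.Incident (P.leftFace (c 0)) v)
    (hk : ∃ v ∈ R, P.Incident (P.leftFace (c k)) v) (hk' : ∃ v ∉ R, P.Incident (P.leftFace (c k)) v)
    {d e : D} (hd : d ∈ P.cut G) (hdt : P.tail d ∉ R) (hdh : P.head d ∉ R)
    (he : e ∈ P.cut G) (het : P.tail e ∉ R) (heh : P.head e ∉ R)
    (hmem : ∃ t < k, d = c t) : ∃ t < k, e = c t := by
  -- The segment is closed up along the boundary of `R`, where every crossed edge has an endpoint in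
  -- `R`.
  obtain ⟨ψ, hψ, hψ0⟩ := exists_isDualChain_along_cut hR hR' hk hk' h₀ h₀'
  have hφ := (isDualChain_pathChain hnext k).add hψ
  have hz : ∀ d, d ∉ P.cut G → P.rev d ∉ P.cut G → P.pathChain c k d = 0 :=
    fun d => pathChain_eq_zero_of_notMem_cut hc k
  have h := hφ.eq_of_connSet hGR hBR
    (fun d a b => by
      rw [Pi.add_apply, hψ0 d a.2 b.2, hz d (fun h => h.2 b.1)
        (fun h => h.2 (by rw [head_rev]; exact a.1)), add_zero])
    (fun d a b => by
      rw [Pi.add_apply, hψ0 d a.2 b.2, hz d (fun h => a.1 h.1) (fun h => b.1 h.1), add_zero])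
    (d := d) (e := e) ⟨hd.1, hdt⟩ ⟨hd.2, hdh⟩ ⟨he.1, het⟩ ⟨he.2, heh⟩
  rw [Pi.add_apply, Pi.add_apply, hψ0 d hdt hdh, hψ0 e het heh, add_zero, add_zero] at h
  by_contra! hne
  rw [(pathChain_eq_zero_iff hc k he).2 hne, pathChain_eq_zero_iff hc k hd] at h
  obtain ⟨t, ht, h'⟩ := hmem
  exact h t ht h'

/-- A face that meets `R`, `G \ R` and `Gᶜ \ R` has an edge between the latter two. -/
theorem exists_edge_avoiding {G R : Set V} (hR : P.ConnSet R) (hR' : P.ConnSet Rᶜ) {f : P.Face}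
    (h₁ : ∃ v ∈ R, P.Incident f v) (h₂ : ∃ v ∈ G \ R, P.Incident f v)
    (h₃ : ∃ v ∈ Gᶜ \ R, P.Incident f v) :
    ∃ e ∈ P.cut G, P.tail e ∉ R ∧ P.head e ∉ R ∧ (P.leftFace e = f ∨ P.rightFace e = f) := by
  obtain ⟨u, hu, hfu⟩ := h₁
  obtain ⟨v, hv, hfv⟩ := h₂
  obtain ⟨w, hw, hfw⟩ := h₃
  obtain ⟨e, he, hef⟩ := exists_mem_cut_leftFace (X := R ∪ G) hfu (.inl hu) hfw
    (by rintro (h | h); exacts [hw.2 h, hw.1 h])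
  obtain ⟨e', he', hef'⟩ := exists_mem_cut_leftFace (X := R ∪ Gᶜ) hfu (.inl hu) hfv
    (by rintro (h | h); exacts [hv.2 h, h hv.1])
  have h1 : P.head e ∉ R := fun h => he.2 (.inl h)
  have h2 : P.head e ∉ G := fun h => he.2 (.inr h)
  have h3 : P.head e' ∉ R := fun h => he'.2 (.inl h)
  have h4 : P.head e' ∈ G := by by_contra h; exact he'.2 (.inr h)
  by_cases het : P.tail e ∈ R
  -- If both arcs started in `R`, they would be arcs of its bond with the same left face, hence
  -- equal, but their heads lie on different sides of `G`.
  · by_cases het' : P.tail e' ∈ R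
    · rw [eq_of_mem_cut_of_leftFace_eq hR hR' (d := e) (e := e') ⟨het, h1⟩ ⟨het', h3⟩
        (hef.trans hef'.symm)] at h2
      exact absurd h4 h2
    · have h5 : P.tail e' ∉ G := he'.1.resolve_left het'
      exact ⟨P.rev e', ⟨h4, by rwa [head_rev]⟩, h3, by rwa [head_rev], .inr (by
        rwa [rightFace_rev])⟩
  · exact ⟨e, ⟨he.1.resolve_left het, h2⟩, het, h1, .inl hef⟩

/-- The duals of the arcs of the bond of `G` that meet the third cell `R` form a contiguous subpath
of the dual cycle, and its endpoints are the faces that meet all three cells. -/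
theorem exists_interval_of_cells {G R : Set V} (hR : P.ConnSet R)
    (hGR : P.ConnSet (G \ R)) (hBR : P.ConnSet (Gᶜ \ R)) {n : ℕ} (hn : n ≠ 0) {c : ZMod n → D}
    (hc : P.IsSimpleDualCycle c (P.cut G)) {q : ZMod n → Prop}
    (hq : ∀ j, q j ↔ P.tail (c j) ∈ R ∨ P.head (c j) ∈ R) :
    ∃ (s : ZMod n) (m : ℕ), m ≤ n ∧ (∀ j, q j ↔ ∃ t < m, j = s + (t : ZMod n)) ∧
      ((∃ j, q j) → (∃ j, ¬q j) →
        (∀ j, (q j ↔ ¬q (j - 1)) ↔ (j = s ∨ j = s + (m : ZMod n))) ∧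
        ∀ f, ((∃ v ∈ R, P.Incident f v) ∧ (∃ v ∈ G \ R, P.Incident f v) ∧
          ∃ v ∈ Gᶜ \ R, P.Incident f v) ↔ ∃ j, f = P.leftFace (c j) ∧ (q j ↔ ¬q (j - 1))) := by
  have : NeZero n := ⟨hn⟩
  obtain ⟨hrange, hnext, hinj⟩ := hc
  have hcm : ∀ z, c z ∈ P.cut G := fun z => hrange ▸ ⟨z, rfl⟩
  have hcinj : Function.Injective c := fun z z' h => hinj (congrArg P.leftFace h)
  have hnext' : ∀ z, P.rightFace (c (z - 1)) = P.leftFace (c z) := fun z => by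
    rw [hnext, sub_add_cancel]
  by_cases hall : ∀ j, q j
  · refine ⟨0, n, le_rfl, fun j => ?_, fun _ h => absurd h (by simpa using hall)⟩
    simp only [hall, true_iff]
    exact ⟨j.val, ZMod.val_lt j, by simp⟩
  by_cases hnone : ∀ j, ¬q j
  · exact ⟨0, 0, Nat.zero_le _, fun j => by simp [hnone],
      fun ⟨j, hj⟩ => absurd hj (hnone j)⟩
  push Not at hall hnone
  obtain ⟨z', hz'⟩ := hall
  obtain ⟨z, hz⟩ := hnone
  have hnq : ∀ {j}, ¬q j → P.tail (c j) ∉ R ∧ P.head (c j) ∉ R := fun {j} h => by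
    rwa [hq, not_or] at h
  -- A bisector arc avoiding `R` joins `G \ R` to `Gᶜ \ R`, so the boundary of `R` is a bond.
  have hR' : P.ConnSet Rᶜ := by
    have h := hGR.union hBR (c z') ⟨(hcm z').1, (hnq hz').1⟩ ⟨(hcm z').2, (hnq hz').2⟩
    convert h using 1
    ext v
    simp only [Set.mem_compl_iff, Set.mem_union, Set.mem_sdiff]
    tauto
  -- faces next to arcs that meet `R`, or that avoid `R`
  have hleft : ∀ j, q j → ∃ v ∈ R, P.Incident (P.leftFace (c j)) v := fun j h => by
    rcases (hq j).1 h with h | h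
    exacts [⟨_, h, P.incident_tail _⟩, ⟨_, h, P.incident_head _⟩]
  have hright : ∀ j, q (j - 1) → ∃ v ∈ R, P.Incident (P.leftFace (c j)) v := fun j h => by
    rw [← hnext']
    rcases (hq _).1 h with h | h
    exacts [⟨_, h, P.incident_right_tail _⟩, ⟨_, h, P.incident_right_head _⟩]
  have hleft' : ∀ j, ¬q j → (∃ v ∈ G \ R, P.Incident (P.leftFace (c j)) v) ∧
      ∃ v ∈ Gᶜ \ R, P.Incident (P.leftFace (c j)) v := fun j h =>
    ⟨⟨_, ⟨(hcm j).1, (hnq h).1⟩, P.incident_tail _⟩,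
      ⟨_, ⟨(hcm j).2, (hnq h).2⟩, P.incident_head _⟩⟩
  have hright' : ∀ j, ¬q (j - 1) → (∃ v ∈ G \ R, P.Incident (P.leftFace (c j)) v) ∧
      ∃ v ∈ Gᶜ \ R, P.Incident (P.leftFace (c j)) v := fun j h => by
    rw [← hnext']
    exact ⟨⟨_, ⟨(hcm _).1, (hnq h).1⟩, P.incident_right_tail _⟩,
      ⟨_, ⟨(hcm _).2, (hnq h).2⟩, P.incident_right_head _⟩⟩
  have hweak : ∀ f, (∃ v ∈ G \ R, P.Incident f v) → ∃ v ∉ R, P.Incident f v :=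
    fun f ⟨v, hv, h⟩ => ⟨v, hv.2, h⟩
  obtain ⟨i, hi, hi'⟩ := ZMod.exists_mem_sub_one_notMem hn hz hz'
  -- the maximal run of arcs avoiding `R` that starts at `i`
  have hex : ∃ k : ℕ, q (i + (k : ZMod n)) := by
    refine ⟨(z - i).val, ?_⟩
    rw [ZMod.natCast_zmod_val]; simpa using hz
  classical
  obtain ⟨k, hk, hkmin⟩ : ∃ k : ℕ, q (i + (k : ZMod n)) ∧ ∀ t < k, ¬q (i + (t : ZMod n)) :=
    ⟨Nat.find hex, Nat.find_spec hex, fun t ht => Nat.find_min hex ht⟩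
  have hk0 : 0 < k := by
    rcases Nat.eq_zero_or_pos k with h | h
    · subst h; simp only [Nat.cast_zero, add_zero] at hk; exact absurd hk hi'
    · exact h
  have elast : i + ((n - 1 : ℕ) : ZMod n) = i - 1 := by
    rw [Nat.cast_sub (by omega)]; simp; ring
  -- Offset `n - 1` is the index `i - 1`, where `q` holds.
  have hkn : k < n := by
    by_contra! h
    exact hkmin (n - 1) (by omega) (by rwa [elast])
  have epred : i + (k : ZMod n) - 1 = i + ((k - 1 : ℕ) : ZMod n) := by
    rw [Nat.cast_sub (by omega)]; push_cast; ring
  -- segments of the cycle between faces on the boundary of `R`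
  have hseg : ∀ k : ℕ, (∃ v ∈ R, P.Incident (P.leftFace (c (i + (k : ZMod n)))) v) →
      (∃ v ∉ R, P.Incident (P.leftFace (c (i + (k : ZMod n)))) v) → ∀ j j', ¬q j → ¬q j' →
      (∃ t < k, j = i + (t : ZMod n)) → ∃ t < k, j' = i + (t : ZMod n) := by
    rintro k hk hk' j j' hj hj' ⟨t, ht, rfl⟩
    obtain ⟨t', ht', h⟩ := mem_segment_of_mem_segment hR hR' hGR hBR
      (c := fun t : ℕ => c (i + (t : ZMod n)))
      (fun t => hcm _) (fun t => by rw [hnext]; push_cast; rw [add_assoc])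
      (by simpa using hright i hi) (by simpa using hweak _ (hleft' i hi').1) hk hk'
      (hcm _) (hnq hj).1 (hnq hj).2 (hcm j') (hnq hj').1 (hnq hj').2 ⟨t, ht, rfl⟩
    exact ⟨t', ht', hcinj h⟩
  -- The run contains index `i`, hence every index avoiding `R`: there is no second run.
  have hrun : ∀ j, ¬q j → ∃ t < k, j = i + (t : ZMod n) := fun j hj =>
    hseg k (hleft _ hk) (hweak _ (hright' _ (by
      rw [epred]; exact hkmin _ (by omega))).1) i j hi' hj ⟨0, hk0, by simp⟩
  have hcast : ∀ a b : ℕ, a < n → b < n → i + (a : ZMod n) = i + (b : ZMod n) → a = b := by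
    intro a b ha hb h
    rw [add_right_inj, ZMod.natCast_eq_natCast_iff, Nat.ModEq, Nat.mod_eq_of_lt ha,
      Nat.mod_eq_of_lt hb] at h
    exact h
  have hsm : i + (k : ZMod n) + ((n - k : ℕ) : ZMod n) = i := by
    rw [Nat.cast_sub hkn.le]; simp
  have hqint : ∀ j, q j ↔ ∃ t < n - k, j = i + (k : ZMod n) + (t : ZMod n) := by
    intro j
    constructor
    · intro hj
      have hv := ZMod.val_lt (j - i)
      have hj' : j = i + ((j - i).val : ZMod n) := by rw [ZMod.natCast_zmod_val]; ring
      have hge : k ≤ (j - i).val := by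
        by_contra! h
        exact hkmin _ h (hj' ▸ hj)
      refine ⟨(j - i).val - k, by omega, ?_⟩
      rw [Nat.cast_sub hge, ZMod.natCast_zmod_val]; ring
    · rintro ⟨t, ht, rfl⟩
      by_contra h
      obtain ⟨t', ht', h'⟩ := hrun _ h
      rw [add_assoc, ← Nat.cast_add] at h'
      have := hcast _ _ (by omega) (by omega) h'
      omega
  refine ⟨i + (k : ZMod n), n - k, Nat.sub_le _ _, hqint, fun _ _ => ⟨fun j => ?_, fun f => ?_⟩⟩
  · rw [hsm]
    constructor
    · intro h
      by_cases hj : q j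
      · left
        obtain ⟨t, ht, rfl⟩ := (hqint j).1 hj
        rcases Nat.eq_zero_or_pos t with rfl | h0
        · simp
        · refine absurd ((hqint _).2 ⟨t - 1, by omega, ?_⟩) (h.1 hj)
          rw [Nat.cast_sub (by omega)]; push_cast; ring
      · right
        have hj1 : q (j - 1) := by by_contra h'; exact hj (h.2 h')
        obtain ⟨t, ht, h'⟩ := (hqint _).1 hj1
        have hj' : j = i + (k : ZMod n) + ((t + 1 : ℕ) : ZMod n) := by
          push_cast; rw [← add_assoc, ← h']; ring
        have : t + 1 = n - k := by
          by_contra hne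
          exact hj ((hqint _).2 ⟨t + 1, by omega, hj'⟩)
        rw [hj', this, hsm]
    · rintro (rfl | rfl)
      · simp only [hk, true_iff, epred]
        exact hkmin _ (by omega)
      · simp [hi, hi']
  · constructor
    · rintro ⟨hf1, hf2, hf3⟩
      obtain ⟨j, rfl⟩ : ∃ j, f = P.leftFace (c j) := by
        obtain ⟨v, hv, hfv⟩ := hf2
        obtain ⟨w, hw, hfw⟩ := hf3
        obtain ⟨e, he, rfl⟩ := exists_mem_cut_leftFace hfv hv.1 hfw hw.1
        rw [← hrange] at he
        obtain ⟨j, rfl⟩ := he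
        exact ⟨j, rfl⟩
      refine ⟨j, rfl, ?_⟩
      by_cases hj : q j <;> by_cases hj1 : q (j - 1) <;> simp only [hj, hj1, not_true,
        not_false_iff, iff_false, iff_true]
      · -- both neighbours meet `R`
        obtain ⟨e, he, het, heh, hef⟩ := exists_edge_avoiding hR hR' hf1 hf2 hf3
        rw [← hrange] at he
        obtain ⟨j', rfl⟩ := he
        have hj' : ¬q j' := by rw [hq]; exact not_or.2 ⟨het, heh⟩
        rcases hef with h | h
        · exact hj' (hinj h ▸ hj)
        · rw [hnext] at h
          have := hinj h
          rw [← this, add_sub_cancel_right] at hj1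
          exact hj' hj1
      · -- both neighbours avoid `R`
        obtain ⟨t, ht, h⟩ := hrun j hj
        have ht0 : t ≠ 0 := by
          rintro rfl
          simp only [Nat.cast_zero, add_zero] at h
          exact hj1 (h ▸ hi)
        -- The run could be stopped at this face already, which would put the offset `t` of `j`
        -- strictly below `t`.
        obtain ⟨t', ht', h'⟩ := hseg t (h ▸ hf1) (h ▸ hweak _ hf2) i j hi' hj
          ⟨0, Nat.pos_of_ne_zero ht0, by simp⟩
        have := hcast _ _ (by omega) (by omega) (h.symm.trans h')
        omega
    · rintro ⟨j, rfl, h⟩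
      by_cases hj : q j
      · exact ⟨hleft j hj, hright' j (h.1 hj)⟩
      · exact ⟨hright j (by by_contra h'; exact hj (h.2 h')), hleft' j hj⟩

end PlaneGraph

/-! ### The cells of the Voronoi diagrams -/

namespace PlaneGraph

variable {V D : Type*} [Fintype V] [Fintype D] {P : PlaneGraph V D}

/-- The cell of `g` in the Voronoi diagram of `g` and `b`. -/
theorem mem_vor_pair {ℓ : D → WithTop ℝ} {ω : V → ℝ} {g b : V} (hgb : g ≠ b) (v : V) :
    v ∈ P.vor ℓ {g, b} ω g ↔ ω g + P.dist ℓ g v < ω b + P.dist ℓ b v := by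
  simp [vor, hgb.symm]

theorem bisector_eq_cut {ℓ : D → WithTop ℝ} {ω : V → ℝ} {g b : V} (hgb : g ≠ b)
    (htie : ∀ v, ω g + P.dist ℓ g v ≠ ω b + P.dist ℓ b v) :
    P.bisector ℓ ω g b = P.cut {v | ω g + P.dist ℓ g v < ω b + P.dist ℓ b v} := by
  ext d
  rw [bisector, Set.mem_ofPred_eq, mem_vor_pair hgb, Set.pair_comm g b, mem_vor_pair hgb.symm, cut]
  simp only [Set.mem_ofPred_eq, not_lt]
  exact and_congr_right fun _ => (htie _).symm.le_iff_lt.symm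

theorem le_vertexDelta {ℓ : D → WithTop ℝ} {ω : V → ℝ} {r g b v : V} {x : ℝ} :
    x ≤ P.vertexDelta ℓ ω r g b v ↔
      x + P.dist ℓ r v ≤ ω g + P.dist ℓ g v ∧ x + P.dist ℓ r v ≤ ω b + P.dist ℓ b v := by
  simp only [vertexDelta, deltaTilde, le_min_iff, le_sub_iff_add_le]

variable [DecidableEq V]

theorem mem_cellAt_self {ℓ : D → WithTop ℝ} {ω : V → ℝ} {r g b : V} (hrg : r ≠ g) (hrb : r ≠ b)
    {x : ℝ} (v : V) : v ∈ P.cellAt ℓ ω r g b x r ↔ x ≤ P.vertexDelta ℓ ω r g b v := by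
  rw [le_vertexDelta]
  simp [cellAt, vorTie, hrg.symm, hrb.symm, le_iff_lt_or_eq]

/-- A vertex that is not red prefers `g` or `b` to `r`; where `g` beats `b`, it prefers `g` in
either case. -/
theorem mem_cellAt_left {ℓ : D → WithTop ℝ} {ω : V → ℝ} {r g b : V} (hrg : r ≠ g) (hrb : r ≠ b)
    (hgb : g ≠ b) {x : ℝ} (v : V) : v ∈ P.cellAt ℓ ω r g b x g ↔
      ω g + P.dist ℓ g v < ω b + P.dist ℓ b v ∧ ¬x ≤ P.vertexDelta ℓ ω r g b v := by
  rw [le_vertexDelta]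
  simp only [cellAt, vorTie, Set.mem_insert_iff, Set.mem_singleton_iff, forall_eq_or_imp, forall_eq,
    Set.mem_ofPred_eq, hrg, hrg.symm, hrb.symm, hgb.symm, Function.update_self, ne_eq,
    Function.update_of_ne, not_false_eq_true, not_true_eq_false, false_and, or_false, forall_true_left,
    IsEmpty.forall_iff, true_and, not_and_or, not_le]
  constructor
  · rintro ⟨h1, h2⟩
    exact ⟨h2, .inl h1⟩
  · rintro ⟨h1, h2 | h2⟩
    exacts [⟨h2, h1⟩, ⟨h1.trans h2, h1⟩]

theorem mem_cellAt_right {ℓ : D → WithTop ℝ} {ω : V → ℝ} {r g b : V} (hrg : r ≠ g) (hrb : r ≠ b)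
    (hgb : g ≠ b) {x : ℝ} (v : V) : v ∈ P.cellAt ℓ ω r g b x b ↔
      ω b + P.dist ℓ b v < ω g + P.dist ℓ g v ∧ ¬x ≤ P.vertexDelta ℓ ω r g b v := by
  rw [le_vertexDelta]
  simp only [cellAt, vorTie, Set.mem_insert_iff, Set.mem_singleton_iff, forall_eq_or_imp, forall_eq,
    Set.mem_ofPred_eq, hrb, hrg.symm, hrb.symm, hgb, Function.update_self, ne_eq,
    Function.update_of_ne, not_false_eq_true, not_true_eq_false, false_and, or_false, forall_true_left,
    IsEmpty.forall_iff, and_true, not_and_or, not_le]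
  constructor
  · rintro ⟨h1, h2⟩
    exact ⟨h2, .inr h1⟩
  · rintro ⟨h1, h2 | h2⟩
    exacts [⟨h1.trans h2, h1⟩, ⟨h2, h1⟩]

omit [DecidableEq V] in
/-- The red cell and the parts of the other two cells outside it are connected, and each contains
its site unless it is empty. -/
theorem connSet_cells {ℓ : D → WithTop ℝ} (hℓ : P.NoNegativeCycle ℓ) {r g b : V}
    (hr : ∀ v, P.FinitelyReachable ℓ r v) (hg : ∀ v, P.FinitelyReachable ℓ g v)
    (hb : ∀ v, P.FinitelyReachable ℓ b v) (ω : V → ℝ) (x : ℝ) :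
    (P.ConnSet {v | x ≤ P.vertexDelta ℓ ω r g b v} ∧ ∀ v, x ≤ P.vertexDelta ℓ ω r g b v →
        x ≤ P.vertexDelta ℓ ω r g b r) ∧
      P.ConnSet {v | ω g + P.dist ℓ g v < ω b + P.dist ℓ b v ∧
        ¬x ≤ P.vertexDelta ℓ ω r g b v} ∧
      ∀ v, ω g + P.dist ℓ g v < ω b + P.dist ℓ b v ∧ ¬x ≤ P.vertexDelta ℓ ω r g b v →
        ω g + P.dist ℓ g g < ω b + P.dist ℓ b g ∧ ¬x ≤ P.vertexDelta ℓ ω r g b g := by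
  have pr := isPotential_dist hℓ hr x
  have pg := isPotential_dist hℓ hg (ω g)
  have pb := isPotential_dist hℓ hb (ω b)
  refine ⟨?_, ?_⟩
  · -- lowering `x` a little makes the inequalities strict
    obtain ⟨y, hy, hyx⟩ : ∃ y, (∀ v, P.vertexDelta ℓ ω r g b v < x →
        P.vertexDelta ℓ ω r g b v < y) ∧ y < x := by
      have h1 : ∀ᶠ y in nhdsWithin x (Set.Iio x), ∀ v, P.vertexDelta ℓ ω r g b v < x →
          P.vertexDelta ℓ ω r g b v < y := by
        rw [Filter.eventually_all]
        intro v
        by_cases h : P.vertexDelta ℓ ω r g b v < x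
        · filter_upwards [nhdsWithin_le_nhds (eventually_gt_nhds h)] with y hy _ using hy
        · exact Filter.Eventually.of_forall fun y h' => absurd h' h
      exact (h1.and self_mem_nhdsWithin).exists
    have heq : ∀ v, y + P.dist ℓ r v < min (ω g + P.dist ℓ g v) (ω b + P.dist ℓ b v) ↔
        x ≤ P.vertexDelta ℓ ω r g b v := by
      intro v
      constructor
      · intro h
        by_contra! h'
        have h2 := hy v h'
        rw [lt_min_iff] at h
        have : y ≤ P.vertexDelta ℓ ω r g b v := le_vertexDelta.2 ⟨h.1.le, h.2.le⟩
        exact this.not_gt h2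
      · intro h
        rw [le_vertexDelta] at h
        rw [lt_min_iff]
        constructor <;> linarith [h.1, h.2]
    have h := connSet_cell hℓ hr y (pg.min pb)
    simpa only [heq] using h
  · have heq : ∀ v, ω g + P.dist ℓ g v < min (ω b + P.dist ℓ b v) (x + P.dist ℓ r v) ↔
        ω g + P.dist ℓ g v < ω b + P.dist ℓ b v ∧ ¬x ≤ P.vertexDelta ℓ ω r g b v := by
      intro v
      rw [le_vertexDelta, lt_min_iff, not_and_or, not_le, not_le]
      refine and_congr_right fun h => ⟨.inl, ?_⟩
      rintro (h' | h')
      exacts [h', h.trans h']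
    have h := connSet_cell hℓ hg (ω g) (pb.min pr)
    simpa only [heq] using h

end PlaneGraph

/-! ### The main theorem -/

open PlaneGraph in
theorem mainTheorem8 {V D : Type*} [Fintype V] [DecidableEq V] [Fintype D]
    (P : PlaneGraph V D) (ℓ : D → WithTop ℝ) (hℓ : P.NoNegativeCycle ℓ)
    (r g b : V) (hrg : r ≠ g) (hrb : r ≠ b) (hgb : g ≠ b)
    (hreach : ∀ u ∈ ({r, g, b} : Set V), ∀ v, P.FinitelyReachable ℓ u v)
    (ω : V → ℝ) (htie : ∀ v, ω g + P.dist ℓ g v ≠ ω b + P.dist ℓ b v) :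
    -- a non-empty bisector is a simple cycle of the dual graph
    ((P.bisector ℓ ω g b).Nonempty →
      ∃ (n : ℕ) (c : ZMod n → D), n ≠ 0 ∧ P.IsSimpleDualCycle c (P.bisector ℓ ω g b)) ∧
    -- and, for every enumeration of it as such a cycle,
    ∀ (n : ℕ) (c : ZMod n → D), n ≠ 0 → P.IsSimpleDualCycle c (P.bisector ℓ ω g b) →
      -- the edges with `Δ^r ≥ x` form a contiguous subpath, and if this is neither empty nor
      -- everything, its endpoints are exactly the trichromatic faces
      (∀ x : ℝ, ∃ (s : ZMod n) (m : ℕ), m ≤ n ∧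
        P.Qge ℓ ω r g b x = {d | ∃ j : ℕ, j < m ∧ d = c (s + (j : ZMod n))} ∧
        ((P.Qge ℓ ω r g b x).Nonempty → P.Qge ℓ ω r g b x ≠ P.bisector ℓ ω g b →
          {f | P.Trichromatic ℓ ω r g b x f} =
            {P.leftFace (c s), P.rightFace (c (s + (m : ZMod n) - 1))} ∧
          {f | P.Trichromatic ℓ ω r g b x f} =
            {f | ∃! d, d ∈ P.Qge ℓ ω r g b x ∧ (P.leftFace d = f ∨ P.rightFace d = f)})) ∧
      -- the cyclic sequence of the values of `Δ^r` is weakly bitonic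
      IsCyclicallyWeaklyBitonic (fun i => P.edgeDelta ℓ ω r g b (c i)) ∧
      -- if the three sites lie on one hole `h`, the cycle passes through the dual vertex of `h`,
      -- and the sequence read from there is weakly monotone
      (∀ h : P.Face, P.Incident h r → P.Incident h g → P.Incident h b →
        ∃ s : ZMod n, P.leftFace (c s) = h ∧
          (MonotoneOn (fun t : ℕ => P.edgeDelta ℓ ω r g b (c (s + (t : ZMod n)))) (Set.Iio n) ∨
           AntitoneOn (fun t : ℕ => P.edgeDelta ℓ ω r g b (c (s + (t : ZMod n)))) (Set.Iio n)))
    := by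
  have hr : ∀ v, P.FinitelyReachable ℓ r v := hreach r (by simp)
  have hg : ∀ v, P.FinitelyReachable ℓ g v := hreach g (by simp)
  have hb : ∀ v, P.FinitelyReachable ℓ b v := hreach b (by simp)
  have hbis := bisector_eq_cut hgb htie
  set G : Set V := {v | ω g + P.dist ℓ g v < ω b + P.dist ℓ b v} with hG
  have hGc : Gᶜ = {v | ω b + P.dist ℓ b v < ω g + P.dist ℓ g v} := by
    ext v
    simp only [hG, Set.mem_compl_iff, Set.mem_ofPred_eq, not_lt]
    exact (htie v).symm.le_iff_lt
  have hGconn := connSet_cell hℓ hg (ω g) (isPotential_dist hℓ hb (ω b))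
  have hBconn := connSet_cell hℓ hb (ω b) (isPotential_dist hℓ hg (ω g))
  rw [← hGc] at hBconn
  rw [hbis]
  refine ⟨fun hne => exists_isSimpleDualCycle_cut hGconn.1 hBconn.1 hne, fun n c hn hc => ?_⟩
  have : NeZero n := ⟨hn⟩
  have hcm : ∀ z, c z ∈ P.cut G := fun z => hc.1 ▸ ⟨z, rfl⟩
  have hcinj : Function.Injective c := fun z z' h => hc.2.2 (congrArg P.leftFace h)
  have hnext' : ∀ z, P.rightFace (c (z - 1)) = P.leftFace (c z) := fun z => by
    rw [hc.2.1, sub_add_cancel]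
  set a : ZMod n → ℝ := fun i => P.edgeDelta ℓ ω r g b (c i) with ha
  have hsymm : ∀ v, P.vertexDelta ℓ ω r b g v = P.vertexDelta ℓ ω r g b v := fun v => min_comm _ _
  have hqa : ∀ x j, x ≤ a j ↔ P.tail (c j) ∈ {v | x ≤ P.vertexDelta ℓ ω r g b v} ∨
      P.head (c j) ∈ {v | x ≤ P.vertexDelta ℓ ω r g b v} := fun x j => le_max_iff
  have hGR : ∀ x, G \ {v | x ≤ P.vertexDelta ℓ ω r g b v} =
      {v | ω g + P.dist ℓ g v < ω b + P.dist ℓ b v ∧ ¬x ≤ P.vertexDelta ℓ ω r g b v} :=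
    fun x => rfl
  have hBR : ∀ x, Gᶜ \ {v | x ≤ P.vertexDelta ℓ ω r g b v} =
      {v | ω b + P.dist ℓ b v < ω g + P.dist ℓ g v ∧ ¬x ≤ P.vertexDelta ℓ ω r g b v} :=
    fun x => by rw [hGc]; rfl
  have hcellR := fun x => connSet_cells hℓ hr hg hb ω x
  -- The cell of `b` is handled by exchanging `g` and `b`, under which `Δ^r` is symmetric.
  have hcellB := fun x => (connSet_cells hℓ hr hb hg ω x).2
  simp only [hsymm] at hcellB
  have main := fun x => exists_interval_of_cells (hcellR x).1.1 (by rw [hGR]; exact (hcellR x).2.1)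
    (by rw [hBR]; exact (hcellB x).1) hn hc (hqa x)
  have htri : ∀ x f, P.Trichromatic ℓ ω r g b x f ↔
      ((∃ v ∈ {v | x ≤ P.vertexDelta ℓ ω r g b v}, P.Incident f v) ∧
        (∃ v ∈ G \ {v | x ≤ P.vertexDelta ℓ ω r g b v}, P.Incident f v) ∧
        ∃ v ∈ Gᶜ \ {v | x ≤ P.vertexDelta ℓ ω r g b v}, P.Incident f v) := fun x f => by
    simp only [hGR, hBR, Trichromatic, Set.mem_insert_iff, Set.mem_singleton_iff, forall_eq_or_imp,
      forall_eq, mem_cellAt_self hrg hrb, mem_cellAt_left hrg hrb hgb, mem_cellAt_right hrg hrb hgb,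
      Set.mem_ofPred_eq]
  have hsuper : ∀ x, ∃ (s : ZMod n) (m : ℕ), m ≤ n ∧
      ∀ j, x ≤ a j ↔ ∃ t < m, j = s + (t : ZMod n) := fun x => by
    obtain ⟨s, m, hm, h, -⟩ := main x
    exact ⟨s, m, hm, h⟩
  have hQ : ∀ x d, d ∈ P.Qge ℓ ω r g b x ↔ ∃ j, d = c j ∧ x ≤ a j := fun x d => by
    rw [Qge, hbis, ← hc.1]
    constructor
    · rintro ⟨⟨j, rfl⟩, h⟩; exact ⟨j, rfl, h⟩
    · rintro ⟨j, rfl, h⟩; exact ⟨⟨j, rfl⟩, h⟩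
  refine ⟨fun x => ?_, isCyclicallyWeaklyBitonic_of_superlevel hn a hsuper, fun h hhr hhg hhb => ?_⟩
  · obtain ⟨s, m, hm, hq, hrest⟩ := main x
    refine ⟨s, m, hm, ?_, fun hne hall => ?_⟩
    · ext d
      rw [hQ]
      constructor
      · rintro ⟨j, rfl, hj⟩
        obtain ⟨t, ht, rfl⟩ := (hq j).1 hj
        exact ⟨t, ht, rfl⟩
      · rintro ⟨t, ht, rfl⟩
        exact ⟨_, rfl, (hq _).2 ⟨t, ht, rfl⟩⟩
    have hne' : ∃ j, x ≤ a j := by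
      obtain ⟨d, hd⟩ := hne
      obtain ⟨j, -, hj⟩ := (hQ x d).1 hd
      exact ⟨j, hj⟩
    have hall' : ∃ j, ¬x ≤ a j := by
      by_contra! h
      refine hall (Set.ext fun d => ?_)
      rw [hQ, ← hc.1]
      exact ⟨fun ⟨j, h1, _⟩ => ⟨j, h1.symm⟩, fun ⟨j, h1⟩ => ⟨j, h1.symm, h j⟩⟩
    obtain ⟨hends, hfaces⟩ := hrest hne' hall'
    -- A proper non-empty subset excludes a cycle of length one, where the two edges at a dual
    -- vertex would coincide.
    have hone : ∀ j : ZMod n, j ≠ j - 1 := by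
      obtain ⟨j₁, h₁⟩ := hne'
      obtain ⟨j₂, h₂⟩ := hall'
      intro j hj
      have h10 : (1 : ZMod n) = 0 := by simpa using hj.symm
      have : Subsingleton (ZMod n) := subsingleton_of_zero_eq_one h10.symm
      exact h₂ (Subsingleton.elim j₁ j₂ ▸ h₁)
    constructor
    · ext f
      rw [Set.mem_ofPred_eq, htri, hfaces, hnext']
      simp only [hends, Set.mem_insert_iff, Set.mem_singleton_iff]
      constructor
      · rintro ⟨j, rfl, rfl | rfl⟩
        exacts [.inl rfl, .inr rfl]
      · rintro (rfl | rfl)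
        exacts [⟨_, rfl, .inl rfl⟩, ⟨_, rfl, .inr rfl⟩]
    · ext f
      rw [Set.mem_ofPred_eq, htri, hfaces, Set.mem_ofPred_eq]
      have hinc : ∀ j d, (d ∈ P.Qge ℓ ω r g b x ∧
          (P.leftFace d = P.leftFace (c j) ∨ P.rightFace d = P.leftFace (c j))) ↔
          (d = c j ∧ x ≤ a j) ∨ (d = c (j - 1) ∧ x ≤ a (j - 1)) := by
        intro j d
        rw [hQ]
        constructor
        · rintro ⟨⟨z, rfl, hz⟩, h | h⟩
          · obtain rfl := hc.2.2 h
            exact .inl ⟨rfl, hz⟩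
          · rw [hc.2.1] at h
            obtain rfl := hc.2.2 h
            rw [add_sub_cancel_right]
            exact .inr ⟨rfl, hz⟩
        · rintro (⟨rfl, h⟩ | ⟨rfl, h⟩)
          exacts [⟨⟨_, rfl, h⟩, .inl rfl⟩, ⟨⟨_, rfl, h⟩, .inr (hnext' _)⟩]
      constructor
      · rintro ⟨j, rfl, hj⟩
        simp only [hinc]
        by_cases h : x ≤ a j
        · exact ⟨c j, .inl ⟨rfl, h⟩, fun d hd => hd.elim And.left fun h' => absurd h'.2 (hj.1 h)⟩
        · have h' : x ≤ a (j - 1) := by by_contra h'; exact h (hj.2 h')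
          exact ⟨c (j - 1), .inr ⟨rfl, h'⟩, fun d hd => hd.elim (fun h' => absurd h'.2 h) And.left⟩
      · intro huniq
        obtain ⟨j, rfl⟩ : ∃ j, f = P.leftFace (c j) := by
          obtain ⟨d, ⟨hd, hdf⟩, -⟩ := huniq
          obtain ⟨z, rfl, -⟩ := (hQ x d).1 hd
          rcases hdf with h | h
          exacts [⟨z, h.symm⟩, ⟨z + 1, by rw [← h, hc.2.1]⟩]
        refine ⟨j, rfl, ?_⟩
        simp only [hinc] at huniq
        obtain ⟨d, hd, hd'⟩ := huniq
        constructor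
        · intro h1 h2
          exact hone j (hcinj ((hd' _ (.inl ⟨rfl, h1⟩)).trans (hd' _ (.inr ⟨rfl, h2⟩)).symm))
        · intro h2
          rcases hd with h | h
          exacts [h.2, absurd h.2 h2]
  -- Non-empty cells contain their sites, so `h` meets both sides of the bisector; at each proper
  -- level the same argument makes `h` trichromatic.
  · have hgG : g ∈ G := hGconn.2 _ (hcm 0).1
    have hbG : b ∉ G := by
      have h1 : P.head (c 0) ∈ Gᶜ := (hcm 0).2
      rw [hGc] at h1
      have h2 := hBconn.2 _ h1
      exact fun h' => h2.not_gt h'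
    obtain ⟨e, he, hef⟩ := exists_mem_cut_leftFace hhg hgG hhb hbG
    rw [← hc.1] at he
    obtain ⟨s₀, rfl⟩ := he
    refine ⟨s₀, hef, monotoneOn_or_antitoneOn_of_superlevel hn a hsuper s₀ fun x hex hex' => ?_⟩
    obtain ⟨s, m, hm, hq, hrest⟩ := main x
    obtain ⟨-, hfaces⟩ := hrest hex hex'
    obtain ⟨j₁, h₁⟩ := hex
    obtain ⟨j₂, h₂⟩ := hex'
    rw [hqa, not_or] at h₂
    have hrr : x ≤ P.vertexDelta ℓ ω r g b r := by
      rcases (hqa x j₁).1 h₁ with h | h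
      exacts [(hcellR x).1.2 _ h, (hcellR x).1.2 _ h]
    have hgg := (hcellR x).2.2 _ ⟨(hcm j₂).1, h₂.1⟩
    have hbb := (hcellB x).2 (P.head (c j₂)) (by
      have : P.head (c j₂) ∈ Gᶜ \ {v | x ≤ P.vertexDelta ℓ ω r g b v} := ⟨(hcm j₂).2, h₂.2⟩
      rwa [hBR] at this)
    obtain ⟨j, hj, hj'⟩ := (hfaces h).1 ⟨⟨r, hrr, hhr⟩, ⟨g, hgg, hhg⟩, ⟨b, by rw [hBR]; exact hbb, hhb⟩⟩
    obtain rfl := hc.2.2 (hef.trans hj)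
    exact hj'
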